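/- Write $[\omega]^{\omega}$ for the set of infinite subsets of $\omega$. A family $\mathcal{A}\subseteq[\omega]^{\omega}$ is almost disjoint (AD) if any two different elements of $\mathcal{A}$ have finite intersection; a MAD family is an infinite AD family that is maximal, with respect to inclusion, among AD families. The almost disjointness number $\mathfrak{a}$ is the smallest size of a MAD family. A set $S$ splits $X$ if $S\cap X$ and $X\setminus S$ are both infinite, and the splitting number $\mathfrak{s}$ is the smallest size of a family $\mathcal{S}\subseteq[\omega]^{\omega}$ such that every $X\in[\omega]^{\omega}$ is split by some $S\in\mathcal{S}$. An ideal on $\omega$ is a nonempty family of subsets of $\omega$ closed under subsets and finite unions; an ideal $\mathcal{I}$ is tall if for every $X\in[\omega]^{\omega}$ there is $Y\in\mathcal{I}$ such that $X\cap Y$ is infinite. For an AD family $\mathcal{A}$, let $\mathcal{I}(\mathcal{A})$ be the ideal generated by $\mathcal{A}$ and the finite subsets of $\omega$, and let $\mathcal{I}(\mathcal{A})^{+}=\wp(\omega)\setminus\mathcal{I}(\mathcal{A})$. A tree is a nonempty set $T\subseteq\omega^{<\omega}$ closed under initial segments; it is $\mathcal{I}(\mathcal{A})^{+}$-branching if $\{n\in\omega\mid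 s^{\frown}\langle n\rangle\in T\}\in\mathcal{I}(\mathcal{A})^{+}$ for every $s\in T$, and $[T]$ is the set of all $f\in\omega^{\omega}$ with $f\upharpoonright n\in T$ for all $n\in\omega$. An AD family $\mathcal{A}$ is $+$-Ramsey if for every $\mathcal{I}(\mathcal{A})^{+}$-branching tree $T$ there is $f\in[T]$ such that $\mathrm{im}(f)\in\mathcal{I}(\mathcal{A})^{+}$. Corollary 25. Assume $\mathfrak{s}\leq\mathfrak{a}$. If $\mathcal{I}$ is a tall ideal on $\omega$, then there is a $+$-Ramsey MAD family $\mathcal{A}$ such that $\mathcal{A}\subseteq\mathcal{I}$. -/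

import Mathlib

namespace PlusRamsey

/-- A family of infinite subsets of `ω` any two different members of which have finite
intersection. -/
def IsAD (A : Set (Set ℕ)) : Prop :=
  (∀ X ∈ A, X.Infinite) ∧ A.Pairwise fun X Y => (X ∩ Y).Finite

/-- A MAD family: an infinite almost disjoint family, maximal under inclusion among all
almost disjoint families. (Finite maximal families such as `{ω}` are excluded, as usual.) -/
def IsMAD (A : Set (Set ℕ)) : Prop :=
  A.Infinite ∧ Maximal IsAD A

/-- `S` splits `X`. -/
def Splits (S X : Set ℕ) : Prop :=
  (S ∩ X).Infinite ∧ (X \ S).Infinite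

/-- A family of infinite sets such that every infinite set is split by one of its members. -/
def IsSplittingFamily (𝒮 : Set (Set ℕ)) : Prop :=
  (∀ S ∈ 𝒮, S.Infinite) ∧ ∀ X : Set ℕ, X.Infinite → ∃ S ∈ 𝒮, Splits S X

/-- The splitting number `𝔰`. -/
noncomputable def splittingNumber : Cardinal.{0} :=
  sInf {κ | ∃ 𝒮 : Set (Set ℕ), IsSplittingFamily 𝒮 ∧ Cardinal.mk 𝒮 = κ}

/-- The almost disjointness number `𝔞`: the smallest size of an (infinite) MAD family. -/
noncomputable def almostDisjointnessNumber : Cardinal.{0} :=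
  sInf {κ | ∃ A : Set (Set ℕ), IsMAD A ∧ Cardinal.mk A = κ}

/-- The ideal `𝓘(A)` on `ω` generated by `A` (together with the finite sets): the sets that are
covered, up to finitely many points, by finitely many members of `A`. -/
def generatedIdeal (A : Set (Set ℕ)) : Order.Ideal (Set ℕ) where
  carrier := {X | ∃ F : Set (Set ℕ), F.Finite ∧ F ⊆ A ∧ (X \ ⋃₀ F).Finite}
  lower' := by
    rintro X Y hYX ⟨F, hF, hFA, h⟩
    exact ⟨F, hF, hFA, h.subset (Set.sdiff_subset_sdiff_left hYX)⟩
  nonempty' := ⟨∅, ∅, by simp⟩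
  directed' := by
    rintro X ⟨F, hF, hFA, hX⟩ Y ⟨G, hG, hGA, hY⟩
    refine ⟨X ∪ Y, ⟨F ∪ G, hF.union hG, Set.union_subset hFA hGA, ?_⟩,
      Set.subset_union_left, Set.subset_union_right⟩
    refine (hX.union hY).subset ?_
    rintro x ⟨hx | hx, hn⟩
    · exact Or.inl ⟨hx, fun h => hn (Set.sUnion_mono Set.subset_union_left h)⟩
    · exact Or.inr ⟨hx, fun h => hn (Set.sUnion_mono Set.subset_union_right h)⟩

/-- `generatedIdeal A` is the least ideal containing `A` and all finite sets. -/
theorem isLeast_generatedIdeal (A : Set (Set ℕ)) :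
    IsLeast {J : Order.Ideal (Set ℕ) | A ⊆ J ∧ ∀ X : Set ℕ, X.Finite → X ∈ J}
      (generatedIdeal A) := by
  refine ⟨⟨fun X hX => ⟨{X}, by simp, by simpa using hX, by simp⟩,
    fun X hX => ⟨∅, by simp, by simp, by simpa using hX⟩⟩, ?_⟩
  rintro J ⟨hA, hfin⟩ X ⟨F, hF, hFA, hX⟩
  have hU : ⋃₀ F ∈ J := by
    clear hX
    induction F, hF using Set.Finite.induction_on with
    | empty => simpa using hfin ∅ Set.finite_empty
    | @insert a s _ _ ih =>
      rw [Set.sUnion_insert]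
      exact Order.Ideal.sup_mem (hA (hFA (Set.mem_insert _ _)))
        (ih ((Set.subset_insert _ _).trans hFA))
  exact J.lower (fun x hx => by
    by_cases h : x ∈ ⋃₀ F
    · exact Or.inr h
    · exact Or.inl ⟨hx, h⟩) (Order.Ideal.sup_mem (hfin _ hX) hU)

/-- `𝓘⁺`, the family of `𝓘`-positive sets. -/
def positive (I : Order.Ideal (Set ℕ)) : Set (Set ℕ) := {X | X ∉ I}

/-- The set of immediate successors `suc_T(s)` of a node. -/
def successors (T : Descriptive.tree ℕ) (s : List ℕ) : Set ℕ := {n | s ++ [n] ∈ T}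

/-- A nonempty tree all of whose nodes have their successor set in `𝒳`. -/
def IsBranching (𝒳 : Set (Set ℕ)) (T : Descriptive.tree ℕ) : Prop :=
  [] ∈ T ∧ ∀ s ∈ T, successors T s ∈ 𝒳

/-- The set `[T]` of branches: those `f : ω → ω` all of whose finite restrictions
`⟨f 0, …, f (n - 1)⟩` lie in `T`. -/
def branches (T : Descriptive.tree ℕ) : Set (ℕ → ℕ) :=
  {f | ∀ n : ℕ, (List.range n).map f ∈ T}

/-- Every `𝓘(A)⁺`-branching tree has a branch whose image is in `𝓘(A)⁺`. -/
def IsPlusRamsey (A : Set (Set ℕ)) : Prop :=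
  ∀ T : Descriptive.tree ℕ, IsBranching (positive (generatedIdeal A)) T →
    ∃ f ∈ branches T, Set.range f ∈ positive (generatedIdeal A)

/-- Every infinite subset of `ω` has infinite intersection with a member of `I`. -/
def IsTall (I : Order.Ideal (Set ℕ)) : Prop :=
  ∀ X : Set ℕ, X.Infinite → ∃ Y ∈ I, (X ∩ Y).Infinite

end PlusRamsey

/-!
The family is built in `𝔠` steps, one for each tree. Fix a family `(S_b)` indexed by `b < 𝔰` such
that for every positively branching tree some `S_b` leaves a positively branching part of the tree
on each of its two sides. If `𝔰` is below the bounding number, every splitting family is of this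
kind; otherwise a splitting family and an unbounded family combine to one which splits countably
many sets at once, and this suffices.

Every member of the family is labelled by a node of `2^{<𝔰}` and follows the sides of the `S_b`
which the label prescribes. Members with incompatible labels are then almost disjoint for free,
and a new member with label `σ` only has to avoid the fewer than `𝔰 ≤ 𝔞` members whose labels are
comparable with `σ`; these cannot form a MAD family below a positive set. Splitting a tree over
and over yields a perfect tree of labels, hence `𝔠` incompatible ones, and fewer than `𝔠` labels
have been used so far. So fusion finds in each tree a branch with positive range, and placing
infinitely many new members inside that range keeps it positive for good. Applied to the full
trees on positive sets, the same step makes the family maximal.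
-/

universe u

namespace PlusRamsey

open Set Filter Cardinal

section ModFinite

variable {α : Type*} {X Y Z : Set α} {F : Set (Set α)}

theorem finite_inter_of_finite_sdiff (hYZ : (Y \ Z).Finite) (hXZ : (X ∩ Z).Finite) :
    (X ∩ Y).Finite :=
  (hYZ.union hXZ).subset fun x hx => by
    by_cases hxZ : x ∈ Z
    · exact Or.inr ⟨hx.1, hxZ⟩
    · exact Or.inl ⟨hx.2, hxZ⟩

theorem finite_inter_sUnion (hF : F.Finite) (h : ∀ B ∈ F, (X ∩ B).Finite) :
    (X ∩ ⋃₀ F).Finite := by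
  rw [sUnion_eq_biUnion, inter_iUnion₂]
  exact hF.biUnion h

theorem finite_sdiff_sUnion_inter {A : Set (Set α)} {B : Set α} (hB : B ∈ A) :
    ((X \ ⋃₀ {C ∈ A | (X ∩ C).Infinite}) ∩ B).Finite := by
  by_cases hXB : (X ∩ B).Infinite
  · exact finite_empty.subset fun x hx => hx.1.2 ⟨B, ⟨hB, hXB⟩, hx.2⟩
  · exact (not_infinite.1 hXB).subset (inter_subset_inter_left _ sdiff_subset)

theorem finite_range_sdiff_of_antitone {Y : ℕ → Set α} (hY : Antitone Y) {z : ℕ → α}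
    (hz : ∀ k, z k ∈ Y k) (k : ℕ) : (range z \ Y k).Finite := by
  refine ((finite_Iio k).image z).subset ?_
  rintro _ ⟨⟨m, rfl⟩, hm⟩
  exact ⟨m, lt_of_not_ge fun hkm => hm (hY hkm (hz m)), rfl⟩

end ModFinite

theorem exists_strictMono_mem {W : ℕ → Set ℕ} (hW : ∀ k, (W k).Infinite) :
    ∃ z : ℕ → ℕ, StrictMono z ∧ ∀ k, z k ∈ W k :=
  extraction_forall_of_frequently fun k => Nat.frequently_atTop_iff_infinite.2 (hW k)

section GeneratedIdeal

variable {A B : Set (Set ℕ)} {X Y : Set ℕ}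

theorem IsAD.mono (hA : IsAD A) (h : B ⊆ A) : IsAD B :=
  ⟨fun X hX => hA.1 X (h hX), hA.2.mono h⟩

theorem generatedIdeal_mono : Monotone generatedIdeal :=
  fun _ _ h _ ⟨F, hF, hFA, hX⟩ => ⟨F, hF, hFA.trans h, hX⟩

theorem mem_generatedIdeal_of_mem (h : X ∈ A) : X ∈ generatedIdeal A :=
  (isLeast_generatedIdeal A).1.1 h

theorem mem_generatedIdeal_of_finite (h : X.Finite) : X ∈ generatedIdeal A :=
  (isLeast_generatedIdeal A).1.2 X h

theorem mem_generatedIdeal_of_finite_sdiff (hY : Y ∈ generatedIdeal A) (h : (X \ Y).Finite) :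
    X ∈ generatedIdeal A :=
  (generatedIdeal A).lower (sdiff_union_self.symm ▸ subset_union_left : X ⊆ X \ Y ∪ Y)
    (Order.Ideal.sup_mem (mem_generatedIdeal_of_finite h) hY)

theorem IsAD.notMem_generatedIdeal (hA : IsAD A) (hX : {B ∈ A | (X ∩ B).Infinite}.Infinite) :
    X ∉ generatedIdeal A := by
  rintro ⟨F, hF, hFA, hXF⟩
  refine hX (hF.subset fun B ⟨hB, hXB⟩ => by_contra fun hBF => hXB ?_)
  rw [inter_comm]
  refine finite_inter_of_finite_sdiff hXF (finite_inter_sUnion hF fun C hC => ?_)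
  exact hA.2 hB (hFA hC) fun h => hBF (h ▸ hC)

theorem notMem_generatedIdeal_of_forall_finite_inter (hX : X.Infinite)
    (h : ∀ B ∈ A, (X ∩ B).Finite) : X ∉ generatedIdeal A := by
  rintro ⟨F, hF, hFA, hXF⟩
  have hXX := finite_inter_of_finite_sdiff hXF (finite_inter_sUnion hF fun B hB => h B (hFA hB))
  exact hX (by rwa [inter_self] at hXX)

theorem infinite_sdiff_sUnion_of_notMem_generatedIdeal (hX : X ∉ generatedIdeal A)
    {C : Set (Set ℕ)} (hC : C.Finite) (hCA : C ⊆ A) : (X \ ⋃₀ C).Infinite :=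
  fun h => hX ⟨C, hC, hCA, h⟩

theorem IsAD.exists_seq_of_notMem_generatedIdeal (hA : IsAD A) (hX : X ∉ generatedIdeal A) :
    ∃ Y : ℕ → Set ℕ, (∀ m, (Y m).Infinite ∧ Y m ⊆ X) ∧
      ∀ W : Set ℕ, {m | (W ∩ Y m).Infinite}.Infinite → W ∉ generatedIdeal A := by
  by_cases hC : {B ∈ A | (X ∩ B).Infinite}.Finite
  · set C := {B ∈ A | (X ∩ B).Infinite}
    have hXC := infinite_sdiff_sUnion_of_notMem_generatedIdeal hX hC (sep_subset _ _)
    refine ⟨fun _ => X \ ⋃₀ C, fun _ => ⟨hXC, sdiff_subset⟩, fun W hW hWA => ?_⟩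
    obtain ⟨_, hWX⟩ := hW.nonempty
    refine notMem_generatedIdeal_of_forall_finite_inter hWX (fun B hB => ?_)
      ((generatedIdeal A).lower inter_subset_left hWA)
    exact (finite_sdiff_sUnion_inter hB).subset (inter_subset_inter_left _ inter_subset_right)
  · let e := Set.Infinite.natEmbedding _ hC
    have he : Function.Injective fun m => (e m : Set ℕ) :=
      Subtype.val_injective.comp e.injective
    refine ⟨fun m => X ∩ e m, fun m => ⟨(e m).2.2, inter_subset_left⟩,
      fun W hW => hA.notMem_generatedIdeal ((hW.image he.injOn).mono ?_)⟩
    rintro _ ⟨m, hm, rfl⟩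
    exact ⟨(e m).2.1, Set.Infinite.mono (inter_subset_inter_right _ inter_subset_right) hm⟩

variable {Y : ℕ → Set ℕ}

theorem exists_pseudointersection_of_finite (hY : ∀ k, Y k ∉ generatedIdeal A)
    (hanti : Antitone Y) (hC : {B ∈ A | ∀ k, (Y k ∩ B).Infinite}.Finite) :
    ∃ z : ℕ → ℕ, (∀ k, z k ∈ Y k) ∧ range z ∉ generatedIdeal A := by
  obtain ⟨z, hz, hzY⟩ := exists_strictMono_mem fun k =>
    infinite_sdiff_sUnion_of_notMem_generatedIdeal (hY k) hC (sep_subset _ _)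
  refine ⟨z, fun k => (hzY k).1, notMem_generatedIdeal_of_forall_finite_inter
    (infinite_range_of_injective hz.injective) fun B hB => ?_⟩
  by_cases hBC : ∀ k, (Y k ∩ B).Infinite
  · refine finite_empty.subset ?_
    rintro _ ⟨⟨k, rfl⟩, hkB⟩
    exact (hzY k).2 ⟨B, ⟨hB, hBC⟩, hkB⟩
  · obtain ⟨k, hk⟩ := not_forall.1 hBC
    rw [not_infinite, inter_comm] at hk
    rw [inter_comm]
    exact finite_inter_of_finite_sdiff
      (finite_range_sdiff_of_antitone hanti (fun k => (hzY k).1) k) hk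

theorem IsAD.exists_pseudointersection_of_infinite (hA : IsAD A)
    (hC : {B ∈ A | ∀ k, (Y k ∩ B).Infinite}.Infinite) :
    ∃ z : ℕ → ℕ, (∀ k, z k ∈ Y k) ∧ range z ∉ generatedIdeal A := by
  let e := hC.natEmbedding
  have he : Function.Injective fun m => (e m : Set ℕ) := Subtype.val_injective.comp e.injective
  -- Through the pairing function, `z` visits every `e i` infinitely often.
  obtain ⟨z, hz, hzY⟩ := exists_strictMono_mem
    (W := fun k => Y k ∩ e k.unpair.1) fun k => (e _).2.2 k
  refine ⟨z, fun k => (hzY k).1,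
    hA.notMem_generatedIdeal ((infinite_range_of_injective he).mono ?_)⟩
  rintro _ ⟨i, rfl⟩
  have hzi : Function.Injective fun m => z (Nat.pair i m) := fun m m' h => by
    simpa only [Nat.pair_eq_pair, true_and] using hz.injective h
  refine ⟨(e i).2.1, (infinite_range_of_injective hzi).mono ?_⟩
  rintro _ ⟨m, rfl⟩
  exact ⟨mem_range_self _, by simpa only [Nat.unpair_pair] using (hzY (Nat.pair i m)).2⟩

theorem IsAD.exists_pseudointersection (hA : IsAD A) (hY : ∀ k, Y k ∉ generatedIdeal A)
    (hanti : Antitone Y) : ∃ Z, Z ∉ generatedIdeal A ∧ Z ⊆ Y 0 ∧ ∀ k, (Z \ Y k).Finite := by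
  obtain ⟨z, hzY, hz⟩ : ∃ z : ℕ → ℕ, (∀ k, z k ∈ Y k) ∧ range z ∉ generatedIdeal A := by
    by_cases hC : {B ∈ A | ∀ k, (Y k ∩ B).Infinite}.Finite
    · exact exists_pseudointersection_of_finite hY hanti hC
    · exact hA.exists_pseudointersection_of_infinite hC
  refine ⟨range z, hz, ?_, finite_range_sdiff_of_antitone hanti hzY⟩
  rintro _ ⟨k, rfl⟩
  exact hanti k.zero_le (hzY k)

end GeneratedIdeal

section AlmostDisjointnessNumber

variable {A E : Set (Set ℕ)} {X Y : Set ℕ}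

theorem IsAD.insert_of_finite_inter (hA : IsAD A) (hX : X.Infinite)
    (h : ∀ B ∈ A, (X ∩ B).Finite) : IsAD (insert X A) :=
  ⟨forall_mem_insert.2 ⟨hX, hA.1⟩, hA.2.insert fun B hB _ => ⟨h B hB, inter_comm X B ▸ h B hB⟩⟩

theorem IsAD.exists_infinite_forall_finite_inter (hE : IsAD E) (hinf : E.Infinite)
    (hcard : #E < almostDisjointnessNumber) :
    ∃ Z : Set ℕ, Z.Infinite ∧ ∀ X ∈ E, (Z ∩ X).Finite := by
  have hmax : ¬Maximal IsAD E := fun h => hcard.not_ge (csInf_le' ⟨E, ⟨hinf, h⟩, rfl⟩)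
  obtain ⟨E', hEE', hE'⟩ := (not_maximal_iff_exists_gt hE).1 hmax
  obtain ⟨Z, hZ, hZE⟩ := exists_of_ssubset hEE'
  exact ⟨Z, hE'.1 Z hZ, fun X hX => hE'.2 hZ (hEE'.1 hX) fun h => hZE (h ▸ hX)⟩

theorem IsAD.exists_infinite_subset_forall_finite_inter (hE : IsAD E) (hinf : E.Infinite)
    (hcard : #E < almostDisjointnessNumber) (hEY : ∀ X ∈ E, X ⊆ Y) :
    ∃ Z ⊆ Y, Z.Infinite ∧ ∀ X ∈ E, (Z ∩ X).Finite := by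
  obtain ⟨Z, hZ, hZY, hZE⟩ : ∃ Z : Set ℕ, Z.Infinite ∧ (Z \ Y).Finite ∧
      ∀ X ∈ E, (Z ∩ X).Finite := by
    by_cases hYc : (Yᶜ).Finite
    · obtain ⟨Z, hZ, hZE⟩ := hE.exists_infinite_forall_finite_inter hinf hcard
      exact ⟨Z, hZ, hYc.subset inter_subset_right, hZE⟩
    · have hE' : IsAD (insert Yᶜ E) := hE.insert_of_finite_inter hYc fun X hX =>
        finite_empty.subset fun x hx => hx.1 (hEY X hX hx.2)
      have hcard' : #(insert Yᶜ E : Set (Set ℕ)) ≤ #E :=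
        mk_insert_le.trans_eq (add_one_eq (aleph0_le_mk_iff.2 hinf.to_subtype))
      obtain ⟨Z, hZ, hZE⟩ := hE'.exists_infinite_forall_finite_inter
        (hinf.mono (subset_insert _ _)) (hcard'.trans_lt hcard)
      exact ⟨Z, hZ, hZE _ (mem_insert _ _), fun X hX => hZE X (mem_insert_of_mem _ hX)⟩
  refine ⟨Z ∩ Y, inter_subset_right, fun h => hZ ?_, fun X hX =>
    (hZE X hX).subset (inter_subset_inter_left _ inter_subset_left)⟩
  rw [← inter_union_sdiff Z Y]
  exact h.union hZY

theorem IsAD.image_inter (hA : IsAD A) (h : ∀ B ∈ A, (Y ∩ B).Infinite) :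
    IsAD ((Y ∩ ·) '' A) := by
  refine ⟨forall_mem_image.2 h, ?_⟩
  rintro _ ⟨B, hB, rfl⟩ _ ⟨C, hC, rfl⟩ hne
  exact (hA.2 hB hC fun h => hne (h ▸ rfl)).subset
    (inter_subset_inter inter_subset_right inter_subset_right)

theorem IsAD.injOn_inter (hA : IsAD A) (h : ∀ B ∈ A, (Y ∩ B).Infinite) :
    InjOn (Y ∩ ·) A := fun B hB _ hC hBC => by_contra fun hne =>
  h B hB ((hA.2 hB hC hne).subset fun _ hx =>
    ⟨hx.2, ((congrArg (_ ∈ ·) hBC).mp hx).2⟩)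

theorem IsAD.exists_infinite_subset_of_notMem_generatedIdeal (hA : IsAD A)
    (hcard : #A < almostDisjointnessNumber) (hY : Y ∉ generatedIdeal A) :
    ∃ Z ⊆ Y, Z.Infinite ∧ ∀ B ∈ A, (Z ∩ B).Finite := by
  set C := {B ∈ A | (Y ∩ B).Infinite}
  by_cases hfin : C.Finite
  · exact ⟨Y \ ⋃₀ C, sdiff_subset,
      infinite_sdiff_sUnion_of_notMem_generatedIdeal hY hfin (sep_subset _ _),
      fun B hB => finite_sdiff_sUnion_inter hB⟩
  · have hCA : IsAD C := hA.mono (sep_subset _ _)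
    obtain ⟨Z, hZY, hZ, hZC⟩ :=
      (hCA.image_inter fun B hB => hB.2).exists_infinite_subset_forall_finite_inter (Y := Y)
        (Set.Infinite.image (hCA.injOn_inter fun B hB => hB.2) hfin)
        ((mk_image_le.trans (mk_le_mk_of_subset (sep_subset _ _))).trans_lt hcard)
        (forall_mem_image.2 fun B _ => inter_subset_left)
    refine ⟨Z, hZY, hZ, fun B hB => ?_⟩
    by_cases hYB : (Y ∩ B).Infinite
    · exact (hZC _ ⟨B, ⟨hB, hYB⟩, rfl⟩).subset fun x hx => ⟨hx.1, hZY hx.1, hx.2⟩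
    · exact (not_infinite.1 hYB).subset (inter_subset_inter_left _ hZY)

theorem mk_iUnion_lt_of_finite {ι α : Type u} {κ : Cardinal} (hκ : ℵ₀ ≤ κ) (hι : #ι < κ)
    {F : ι → Set α} (hF : ∀ i, (F i).Finite) : #(⋃ i, F i) < κ := by
  cases finite_or_infinite ι
  · exact (lt_aleph0_iff_set_finite.2 (finite_iUnion hF)).trans_le hκ
  · have hF' : ⨆ i, #(F i) ≤ ℵ₀ := ciSup_le' fun i => (lt_aleph0_iff_set_finite.2 (hF i)).le
    calc #(⋃ i, F i) ≤ #ι * ⨆ i, #(F i) := mk_iUnion_le F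
      _ ≤ #ι * ℵ₀ := mul_le_mul_right hF' _
      _ = #ι := mul_aleph0_eq (aleph0_le_mk ι)
      _ < κ := hι

theorem aleph0_le_almostDisjointnessNumber {c : Cardinal} (hc : c < almostDisjointnessNumber) :
    ℵ₀ ≤ almostDisjointnessNumber := by
  -- If there were no MAD family, the infimum would be `0`.
  obtain ⟨c', hc'⟩ : {κ | ∃ A : Set (Set ℕ), IsMAD A ∧ #A = κ}.Nonempty := by
    by_contra hempty
    rw [not_nonempty_iff_eq_empty] at hempty
    rw [almostDisjointnessNumber, hempty, sInf_empty] at hc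
    exact not_lt_bot hc
  obtain ⟨A, hA, hcard⟩ := csInf_mem ⟨c', hc'⟩
  exact (aleph0_le_mk_iff.2 hA.1.to_subtype).trans_eq hcard

theorem IsAD.exists_infinite_subset_forall_mem_generatedIdeal (hA : IsAD A) {ι : Type}
    (hι : #ι < almostDisjointnessNumber) {N : ι → Set ℕ} (hN : ∀ i, N i ∈ generatedIdeal A)
    (hY : Y ∉ generatedIdeal A) : ∃ Z ⊆ Y, Z.Infinite ∧ ∀ i, (Z ∩ N i).Finite := by
  choose F hF hFA hNF using hN
  have hBA : ⋃ i, F i ⊆ A := iUnion_subset hFA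
  have hcard := mk_iUnion_lt_of_finite (aleph0_le_almostDisjointnessNumber hι) hι hF
  obtain ⟨Z, hZY, hZ, hZF⟩ := (hA.mono hBA).exists_infinite_subset_of_notMem_generatedIdeal hcard
    fun h => hY (generatedIdeal_mono hBA h)
  exact ⟨Z, hZY, hZ, fun i => finite_inter_of_finite_sdiff (hNF i)
    (finite_inter_sUnion (hF i) fun B hB => hZF B (mem_iUnion_of_mem i hB))⟩

end AlmostDisjointnessNumber

section Growth

/-- A strictly increasing function above `f`. -/
def majorant (f : ℕ → ℕ) (n : ℕ) : ℕ := n + 1 + ∑ m ∈ Finset.range (n + 1), f m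

theorem strictMono_majorant (f : ℕ → ℕ) : StrictMono (majorant f) :=
  strictMono_nat_of_lt_succ fun n => by
    rw [majorant, majorant, Finset.sum_range_succ _ (n + 1)]
    lia

theorem lt_majorant (f : ℕ → ℕ) (n : ℕ) : f n < majorant f n := by
  rw [majorant, Finset.sum_range_succ]
  lia

theorem self_lt_majorant (f : ℕ → ℕ) (n : ℕ) : n < majorant f n := by
  rw [majorant]
  lia

theorem exists_strictMono_forall_eventually_lt {σ : Type*} [Countable σ] (φ : σ → ℕ → ℕ) :
    ∃ g : ℕ → ℕ, StrictMono g ∧ ∀ s, ∀ᶠ n in atTop, φ s n < g n := by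
  obtain ⟨e, he⟩ := Countable.exists_injective_nat σ
  let ψ : ℕ → ℕ → ℕ := Function.extend e φ 0
  refine ⟨majorant fun n => ∑ m ∈ Finset.range (n + 1), ψ m n, strictMono_majorant _, fun s => ?_⟩
  filter_upwards [eventually_ge_atTop (e s)] with n hn
  have hψ : ψ (e s) = φ s := he.extend_apply φ 0 s
  calc φ s n = ψ (e s) n := by rw [hψ]
    _ ≤ ∑ m ∈ Finset.range (n + 1), ψ m n :=
      Finset.single_le_sum (f := fun m => ψ m n) (fun _ _ => Nat.zero_le _)
        (Finset.mem_range.2 (Nat.lt_succ_of_le hn))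
    _ < _ := lt_majorant (fun n => ∑ m ∈ Finset.range (n + 1), ψ m n) n

/-- The iterates of `0` under the majorant of `f`; they are the endpoints of an interval
partition of `ω` coding `f`. -/
def orbit (f : ℕ → ℕ) (n : ℕ) : ℕ := (majorant f)^[n] 0

theorem orbit_succ (f : ℕ → ℕ) (n : ℕ) : orbit f (n + 1) = majorant f (orbit f n) :=
  Function.iterate_succ_apply' _ _ _

theorem strictMono_orbit (f : ℕ → ℕ) : StrictMono (orbit f) :=
  strictMono_nat_of_lt_succ fun n => orbit_succ f n ▸ self_lt_majorant f _

theorem exists_mem_Ico_orbit (f : ℕ → ℕ) (x : ℕ) : ∃ n, x ∈ Ico (orbit f n) (orbit f (n + 1)) :=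
  mem_iUnion.1 <| (iUnion_Ico_map_succ_eq_Ici (fun n => (strictMono_orbit f).monotone n.zero_le)
    (strictMono_orbit f).not_bddAbove_range_of_wellFoundedLT).superset x.zero_le

theorem frequently_lt_orbit_succ {f g : ℕ → ℕ} (hg : StrictMono g)
    (h : ∃ᶠ x in atTop, g (g x) < f x) : ∃ᶠ n in atTop, g (orbit f n) < orbit f (n + 1) := by
  refine frequently_atTop.2 fun n₀ => ?_
  obtain ⟨x, hx, hgx⟩ := frequently_atTop.1 h (orbit f n₀)
  obtain ⟨n, hnx, hxn⟩ := exists_mem_Ico_orbit f x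
  have hn : n₀ ≤ n := Nat.lt_succ_iff.1 ((strictMono_orbit f).lt_iff_lt.1 (hx.trans_lt hxn))
  by_cases hn' : g (orbit f n) < orbit f (n + 1)
  · exact ⟨n, hn, hn'⟩
  · refine ⟨n + 1, hn.trans n.le_succ, ?_⟩
    calc g (orbit f (n + 1)) ≤ g (g x) :=
          hg.monotone ((not_lt.1 hn').trans (hg.monotone hnx))
      _ < f x := hgx
      _ < majorant f x := lt_majorant f x
      _ < majorant f (orbit f (n + 1)) := strictMono_majorant f hxn
      _ = orbit f (n + 1 + 1) := (orbit_succ f _).symm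

end Growth

section SplittingNumber

/-- The union of the intervals `[e n, e (n + 1))` with `n ∈ D`. -/
def blockSet (e : ℕ → ℕ) (D : Set ℕ) : Set ℕ := ⋃ n ∈ D, Ico (e n) (e (n + 1))

theorem mem_blockSet_iff {e : ℕ → ℕ} (he : Monotone e) {D : Set ℕ} {n x : ℕ}
    (hx : x ∈ Ico (e n) (e (n + 1))) : x ∈ blockSet e D ↔ n ∈ D := by
  refine ⟨fun h => ?_, fun h => mem_biUnion h hx⟩
  obtain ⟨m, hm, hxm⟩ := mem_iUnion₂.1 h
  rwa [he.pairwise_disjoint_on_Ico_succ.eq (not_disjoint_iff.2 ⟨x, hx, hxm⟩)]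

theorem splits_blockSet {e : ℕ → ℕ} (he : StrictMono e) {X D E : Set ℕ}
    (hE : ∀ᶠ n in atTop, n ∈ E → (X ∩ Ico (e n) (e (n + 1))).Nonempty) (hD : Splits D E) :
    Splits (blockSet e D) X := by
  obtain ⟨N, hN⟩ := eventually_atTop.1 hE
  have hinf {P : Set ℕ} (hP : (E ∩ P).Infinite) (b : ℕ) :
      ∃ n ∈ P, ∃ x ∈ X, b < x ∧ x ∈ Ico (e n) (e (n + 1)) := by
    obtain ⟨n, ⟨hnE, hn⟩, hbn⟩ := hP.exists_gt (max N b)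
    obtain ⟨x, hx, hxn⟩ := hN n (by lia) hnE
    exact ⟨n, hn, x, hx, ((le_max_right N b).trans_lt hbn).trans_le (he.le_apply.trans hxn.1), hxn⟩
  refine ⟨infinite_of_forall_exists_gt fun b => ?_, infinite_of_forall_exists_gt fun b => ?_⟩
  · obtain ⟨n, hn, x, hx, hbx, hxn⟩ := hinf (inter_comm D E ▸ hD.1) b
    exact ⟨x, ⟨(mem_blockSet_iff he.monotone hxn).2 hn, hx⟩, hbx⟩
  · obtain ⟨n, hn, x, hx, hbx, hxn⟩ := hinf (P := Dᶜ) hD.2 b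
    exact ⟨x, ⟨hx, (mem_blockSet_iff he.monotone hxn).not.2 hn⟩, hbx⟩

theorem exists_splits {X : Set ℕ} (hX : X.Infinite) : ∃ S, Splits S X := by
  obtain ⟨S, T, rfl, hST, hcard⟩ := hX.exists_union_disjoint_cardinal_eq_of_infinite
  have hiff : S.Infinite ↔ T.Infinite := by
    rw [← infinite_coe_iff, ← infinite_coe_iff, infinite_iff, infinite_iff, hcard]
  have hS : S.Infinite := (infinite_union.1 hX).elim id hiff.2
  refine ⟨S, by rwa [inter_eq_left.2 subset_union_left], ?_⟩
  rw [union_sdiff_cancel_left hST.le_bot]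
  exact hiff.1 hS

theorem exists_isSplittingFamily_mk_eq :
    ∃ 𝒮 : Set (Set ℕ), IsSplittingFamily 𝒮 ∧ #𝒮 = splittingNumber := by
  refine csInf_mem (s := {κ | ∃ 𝒮 : Set (Set ℕ), IsSplittingFamily 𝒮 ∧ #𝒮 = κ})
    ⟨_, {S | S.Infinite}, ⟨fun S hS => hS, fun X hX => ?_⟩, rfl⟩
  obtain ⟨S, hS⟩ := exists_splits hX
  exact ⟨S, hS.1.mono inter_subset_left, hS⟩

theorem exists_forall_not_splits_of_mk_lt {ι : Type} (hι : #ι < splittingNumber)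
    (S : ι → Set ℕ) : ∃ X : Set ℕ, X.Infinite ∧ ∀ i, ¬Splits (S i) X := by
  by_contra! hcon
  have hfam : IsSplittingFamily {T ∈ range S | T.Infinite} := by
    refine ⟨fun T hT => hT.2, fun X hX => ?_⟩
    obtain ⟨i, hi⟩ := hcon X hX
    exact ⟨S i, ⟨⟨i, rfl⟩, hi.1.mono inter_subset_left⟩, hi⟩
  refine hι.not_ge ?_
  calc splittingNumber ≤ #{T ∈ range S | T.Infinite} := csInf_le' ⟨_, hfam, rfl⟩
    _ ≤ #(range S) := mk_le_mk_of_subset (sep_subset _ _)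
    _ ≤ #ι := mk_range_le

theorem exists_forall_not_splits_of_finite {𝒮 : Set (Set ℕ)} (h𝒮 : 𝒮.Finite) :
    ∃ X : Set ℕ, X.Infinite ∧ ∀ S ∈ 𝒮, ¬Splits S X := by
  let X : Set ℕ := {x | ∀ S ∈ 𝒮, x ∈ S ↔ S ∈ hyperfilter ℕ}
  have hX : X ∈ hyperfilter ℕ := (eventually_all_finite h𝒮).2 fun S _ => by
    by_cases hS : S ∈ hyperfilter ℕ
    · filter_upwards [hS] with x hx
      exact iff_of_true hx hS
    · filter_upwards [Ultrafilter.compl_mem_iff_notMem.2 hS] with x hx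
      exact iff_of_false hx hS
  refine ⟨X, fun hfin => notMem_hyperfilter_of_finite hfin hX, fun S hS h => ?_⟩
  obtain ⟨x, hxS, hxX⟩ := h.1.nonempty
  obtain ⟨y, hyX, hyS⟩ := h.2.nonempty
  exact hyS ((hyX S hS).2 ((hxX S hS).1 hxS))

theorem aleph0_le_splittingNumber : ℵ₀ ≤ splittingNumber := by
  obtain ⟨𝒮, h𝒮, hcard⟩ := exists_isSplittingFamily_mk_eq
  rw [← hcard, aleph0_le_mk_iff, infinite_coe_iff]
  intro hfin
  obtain ⟨X, hX, hXS⟩ := exists_forall_not_splits_of_finite hfin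
  obtain ⟨S, hS, hSX⟩ := h𝒮.2 X hX
  exact hXS S hS hSX

/-- A family of sets that splits any countably many infinite sets simultaneously. -/
def IsOmegaSplitting {K : Type*} (S : K → Set ℕ) : Prop :=
  ∀ X : ℕ → Set ℕ, (∀ m, (X m).Infinite) → ∃ b, ∀ m, Splits (S b) (X m)

theorem isOmegaSplitting_blockSet {ι κ : Type*} {f : ι → ℕ → ℕ}
    (hf : ∀ H : ℕ → ℕ, ∃ i, ∃ᶠ n in atTop, H n < f i n) {S : κ → Set ℕ}
    (hS : ∀ X : Set ℕ, X.Infinite → ∃ k, Splits (S k) X) :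
    IsOmegaSplitting fun p : ι × κ => blockSet (orbit (f p.1)) (S p.2) := by
  intro X hX
  choose a haX ha using fun m k => (hX m).exists_gt k
  obtain ⟨g, hg, hag⟩ := exists_strictMono_forall_eventually_lt a
  obtain ⟨i, hi⟩ := hf fun n => g (g n)
  obtain ⟨k, hk⟩ := hS {n | g (orbit (f i) n) < orbit (f i) (n + 1)}
    (Nat.frequently_atTop_iff_infinite.1 (frequently_lt_orbit_succ hg hi))
  refine ⟨(i, k), fun m => splits_blockSet (strictMono_orbit _) ?_ hk⟩
  filter_upwards [(strictMono_orbit (f i)).tendsto_atTop.eventually (hag m)] with n hn hgn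
  exact ⟨a m _, haX m _, (ha m _).le, hn.trans hgn⟩

theorem exists_forall_frequently_lt_of_mk_lt {ι : Type} (hι : #ι < splittingNumber)
    (h : ι → ℕ → ℕ) : ∃ φ : ℕ → ℕ, ∀ i, ∃ᶠ n in atTop, h i n < φ n := by
  obtain ⟨X, hX, hXh⟩ :=
    exists_forall_not_splits_of_mk_lt hι fun i => blockSet (orbit (h i)) {n | Even n}
  choose φ hφX hφ using hX.exists_gt
  refine ⟨φ, fun i hcon => hXh i (splits_blockSet (strictMono_orbit _) (E := univ) ?_ ?_)⟩
  · filter_upwards [(strictMono_orbit (h i)).tendsto_atTop.eventually hcon] with n hn _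
    refine ⟨φ _, hφX _, (hφ _).le, ?_⟩
    rw [orbit_succ]
    exact (not_lt.1 hn).trans_lt (lt_majorant _ _)
  · rw [Splits, inter_univ, ← compl_eq_univ_sdiff, compl_ofPred]
    simp only [Nat.not_even_iff_odd, ← Nat.frequently_atTop_iff_infinite]
    exact ⟨Nat.frequently_even, Nat.frequently_odd⟩

theorem exists_strictMono_escaping {σ : Type} [Countable σ] {ι : σ → Type}
    (hι : ∀ s, #(ι s) < splittingNumber) (h : ∀ s, ι s → ℕ → ℕ) :
    ∃ g : ℕ → ℕ, StrictMono g ∧ ∀ s i, ∃ᶠ k in atTop, h s i (g k) < g (k + 1) := by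
  choose φ hφ using fun s => exists_forall_frequently_lt_of_mk_lt (hι s)
    fun i x => majorant (h s i) (majorant (h s i) x)
  obtain ⟨ψ, -, hψ⟩ := exists_strictMono_forall_eventually_lt φ
  refine ⟨orbit ψ, strictMono_orbit ψ, fun s i => ?_⟩
  have hhψ := ((hφ s i).and_eventually (hψ s)).mono fun x hx => hx.1.trans hx.2
  exact (frequently_lt_orbit_succ (strictMono_majorant _) hhψ).mono fun k hk =>
    (lt_majorant _ _).trans hk

theorem finite_setOf_length_le_and_forall_mem {α : Type*} {s : Set α} (hs : s.Finite) (m : ℕ) :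
    {w : List α | w.length ≤ m ∧ ∀ e ∈ w, e ∈ s}.Finite := by
  have := hs.to_subtype
  refine ((List.finite_length_le s m).image (List.map (↑))).subset fun w ⟨hw, hws⟩ => ?_
  obtain ⟨v, rfl⟩ : w ∈ range (List.map ((↑) : s → α)) := by rwa [range_list_map_coe]
  exact ⟨v, by simpa only [mem_ofPred, List.length_map] using hw, rfl⟩

theorem exists_eq_of_mem_res {α : Type*} (x : ℕ → α) {k : ℕ} {a : α} (ha : a ∈ PiNat.res x k) :
    ∃ j < k, x j = a := by
  induction k with
  | zero => exact absurd ha List.not_mem_nil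
  | succ k ih =>
    rcases List.mem_cons.1 (PiNat.res_succ x k ▸ ha) with rfl | ha
    · exact ⟨k, k.lt_succ_self, rfl⟩
    · obtain ⟨j, hj, hja⟩ := ih ha
      exact ⟨j, hj.trans k.lt_succ_self, hja⟩

theorem mk_finset_lt {α : Type*} {κ : Cardinal} (hκ : ℵ₀ ≤ κ) (hα : #α < κ) :
    #(Finset α) < κ := by
  cases finite_or_infinite α
  · exact (lt_aleph0_of_finite _).trans_le hκ
  · rwa [mk_finset_of_infinite]

theorem exists_strictMono_history_escaping {σ ι α : Type} [Countable σ] [Finite α]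
    {act : σ → Set ι} (hact : ∀ s, #(act s) < splittingNumber) (h : List (ℕ × α) → ι → ℕ) :
    ∃ g : ℕ → ℕ, StrictMono g ∧ ∀ s, ∀ E : Finset (act s), ∃ᶠ k in atTop, ∀ x : ℕ → α,
      ∀ i ∈ E, h (PiNat.res (fun j => (g j, x j)) k) i < g k := by
  have hbdd (s : σ) (E : Finset (act s)) (m : ℕ) : ∃ M, ∀ w : List (ℕ × α),
      w.length ≤ m + 1 → (∀ e ∈ w, e.1 ∈ Iic m) → ∀ i ∈ E, h w i ≤ M := by
    have hlists := finite_setOf_length_le_and_forall_mem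
      ((finite_Iic m).prod (finite_univ (α := α))) (m + 1)
    obtain ⟨M, hM⟩ := (hlists.image2 (fun w (i : act s) => h w i) E.finite_toSet).bddAbove
    exact ⟨M, fun w hwm hw i hi => hM ⟨w, ⟨hwm, fun e he => ⟨hw e he, mem_univ _⟩⟩, i, hi, rfl⟩⟩
  choose M hM using hbdd
  obtain ⟨g, hg, hMg⟩ := exists_strictMono_escaping
    (fun s => mk_finset_lt aleph0_le_splittingNumber (hact s)) M
  refine ⟨g, hg, fun s E => (tendsto_add_atTop_nat 1).frequently ((hMg s E).mono ?_)⟩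
  refine fun k hk x i hi => (hM s E (g k) _ ?_ ?_ i hi).trans_lt hk
  · rw [PiNat.res_length]
    exact Nat.succ_le_succ hg.le_apply
  · intro e he
    obtain ⟨j, hj, rfl⟩ := exists_eq_of_mem_res _ he
    exact hg.monotone (Nat.le_of_lt_succ hj)

end SplittingNumber

section Side

/-- One of the two sides of the partition of `ω` given by `S`: the set `S` itself for
`c = true` and its complement for `c = false`. -/
def side (S : Set ℕ) (c : Bool) : Set ℕ := {n | n ∈ S ↔ c = true}

theorem side_not (S : Set ℕ) (c : Bool) : side S (!c) = (side S c)ᶜ := by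
  cases c <;> ext <;> simp [side]

theorem Splits.infinite_inter_side {S X : Set ℕ} (h : Splits S X) (c : Bool) :
    (X ∩ side S c).Infinite := by
  cases c
  · convert h.2 using 1
    ext
    simp [side]
  · convert h.1 using 1
    ext
    simp [side, and_comm]

end Side

/-- The splitting nodes of a tree of finite sequences of numbers in which above each successor of a
splitting node there is a further splitting node, together with the `J`-positive sets of
successors of these nodes. -/
structure Skeleton (J : Order.Ideal (Set ℕ)) where
  nodes : Set (List ℕ)
  succ : List ℕ → Set ℕ
  nonempty : nodes.Nonempty
  succ_notMem : ∀ t ∈ nodes, succ t ∉ J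
  exists_extends : ∀ t ∈ nodes, ∀ n ∈ succ t, ∃ t' ∈ nodes, t ++ [n] <+: t'

namespace Skeleton

variable {J : Order.Ideal (Set ℕ)}

instance : Preorder (Skeleton J) where
  le q p := q.nodes ⊆ p.nodes ∧ ∀ t ∈ q.nodes, q.succ t ⊆ p.succ t
  le_refl _ := ⟨subset_rfl, fun _ _ => subset_rfl⟩
  le_trans _ _ _ h h' := ⟨h.1.trans h'.1, fun t ht => (h.2 t ht).trans (h'.2 t (h.1 ht))⟩

/-- The nodes `t k` lie on one branch through `p`, which leaves `t k` by the successor `n k`. -/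
def IsPath (p : Skeleton J) (t : ℕ → List ℕ) (n : ℕ → ℕ) : Prop :=
  ∀ k, t k ∈ p.nodes ∧ n k ∈ p.succ (t k) ∧ t k ++ [n k] <+: t (k + 1)

section IsPath

variable {p q : Skeleton J} {t : ℕ → List ℕ} {n : ℕ → ℕ}

theorem IsPath.mono (h : q.IsPath t n) (hqp : q ≤ p) : p.IsPath t n := fun k =>
  ⟨hqp.1 (h k).1, hqp.2 _ (h k).1 (h k).2.1, (h k).2.2⟩

theorem IsPath.prefix_succ (h : p.IsPath t n) (k : ℕ) : t k <+: t (k + 1) :=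
  (List.prefix_append _ _).trans (h k).2.2

theorem IsPath.injective (h : p.IsPath t n) : Function.Injective t := by
  refine Function.Injective.of_comp (f := List.length) (StrictMono.injective ?_)
  refine strictMono_nat_of_lt_succ fun k => ?_
  simpa [Nat.succ_le_iff] using (h k).2.2.length_le

theorem exists_isPath (p : Skeleton J) {n : p.nodes → ℕ} (hn : ∀ t : p.nodes, n t ∈ p.succ t) :
    ∃ t : ℕ → p.nodes, p.IsPath (fun k => t k) fun k => n (t k) := by
  have hstep : ∀ t : p.nodes, ∃ t' : p.nodes, t.1 ++ [n t] <+: t'.1 := fun t =>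
    let ⟨t', ht', h⟩ := p.exists_extends t t.2 (n t) (hn t)
    ⟨⟨t', ht'⟩, h⟩
  choose next hnext using hstep
  obtain ⟨t₀, ht₀⟩ := p.nonempty
  refine ⟨fun k => next^[k] ⟨t₀, ht₀⟩, fun k => ⟨Subtype.prop _, hn _, ?_⟩⟩
  simpa only [Function.iterate_succ_apply'] using hnext _

end IsPath

section Thin

variable {p q : Skeleton J} {U : Set ℕ} {N : List ℕ → Set ℕ}

/-- The sets `N t` in the ideal witness that `p` has few successors in `U`: along every branch
through `p`, the successors in `U` are eventually caught by the sets `N t`. -/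
def ThinBy (p : Skeleton J) (U : Set ℕ) (N : List ℕ → Set ℕ) : Prop :=
  (∀ t ∈ p.nodes, N t ∈ J) ∧
    ∀ t n, p.IsPath t n → ∀ᶠ k in atTop, n k ∈ U → n k ∈ N (t k)

/-- `p` is thin in `U` if no subskeleton of `p` has all its successor sets inside `U`. This is
expressed by a witness, see `thin_or_exists_le` and `not_thin_of_notMem`. -/
def Thin (p : Skeleton J) (U : Set ℕ) : Prop := ∃ N, p.ThinBy U N

theorem ThinBy.anti (h : p.ThinBy U N) (hqp : q ≤ p) : q.ThinBy U N :=
  ⟨fun t ht => h.1 t (hqp.1 ht), fun t n htn => h.2 t n (htn.mono hqp)⟩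

theorem Thin.anti (h : p.Thin U) (hqp : q ≤ p) : q.Thin U :=
  let ⟨N, hN⟩ := h
  ⟨N, hN.anti hqp⟩

theorem not_thin_of_notMem (h : ∀ t ∈ p.nodes, p.succ t ∩ U ∉ J) : ¬p.Thin U := by
  rintro ⟨N, hNJ, hN⟩
  have hsel : ∀ t : p.nodes, ∃ n ∈ p.succ t ∩ U, n ∉ N t := fun t =>
    not_subset.1 fun hsub => h t t.2 (J.lower hsub (hNJ t t.2))
  choose n hn hnN using hsel
  obtain ⟨t, ht⟩ := p.exists_isPath fun t => (hn t).1
  obtain ⟨k, hk⟩ := (hN _ _ ht).exists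
  exact hnN _ (hk (hn _).2)

theorem thin_of_succ_subset_compl (h : ∀ t ∈ p.nodes, p.succ t ⊆ Uᶜ) : p.Thin U :=
  ⟨fun _ => ∅, fun _ _ => J.bot_mem,
    fun _ _ htn => Eventually.of_forall fun k hk => absurd hk (h _ (htn k).1 (htn k).2.1)⟩

/-- The successors of `t` in `U` below elements of `H`. -/
def succInto (p : Skeleton J) (U : Set ℕ) (H : Set (List ℕ)) (t : List ℕ) : Set ℕ :=
  {n ∈ p.succ t ∩ U | ∃ s ∈ H, t ++ [n] <+: s}

theorem succInto_mono {H H' : Set (List ℕ)} (h : H ⊆ H') (t : List ℕ) :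
    p.succInto U H t ⊆ p.succInto U H' t := fun _ ⟨hn, s, hs, hts⟩ => ⟨hn, s, h hs, hts⟩

/-- The Cantor–Bendixson style derivative: it keeps of `H` the sequences above which there is a
node with positively many successors in `U` below elements of `H`. -/
def derivative (p : Skeleton J) (U : Set ℕ) : Set (List ℕ) →o Set (List ℕ) where
  toFun H := {t | ∃ t' ∈ p.nodes, t <+: t' ∧ p.succInto U H t' ∉ J}
  monotone' _ _ hH := fun _ ⟨t', ht', htt', h⟩ =>
    ⟨t', ht', htt', fun hJ => h (J.lower (succInto_mono hH t') hJ)⟩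

theorem mem_derivative_of_isPrefix {H : Set (List ℕ)} {t t' : List ℕ} (htt' : t <+: t')
    (h : t' ∈ p.derivative U H) : t ∈ p.derivative U H :=
  let ⟨s, hs, hs', hpos⟩ := h
  ⟨s, hs, htt'.trans hs', hpos⟩

theorem exists_le_of_mem_gfp_derivative {t : List ℕ} (ht : t ∈ (p.derivative U).gfp) :
    ∃ q ≤ p, ∀ t ∈ q.nodes, q.succ t ⊆ U := by
  set G := (p.derivative U).gfp with hG
  have hext : ∀ t ∈ G, ∃ t' ∈ {t ∈ p.nodes | p.succInto U G t ∉ J}, t <+: t' := by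
    intro t ht
    rw [hG, ← OrderHom.map_gfp] at ht
    obtain ⟨t', ht', htt', hpos⟩ := ht
    exact ⟨t', ⟨ht', hpos⟩, htt'⟩
  let q : Skeleton J :=
    { nodes := {t ∈ p.nodes | p.succInto U G t ∉ J}
      succ := p.succInto U G
      nonempty := let ⟨t', ht', _⟩ := hext t ht; ⟨t', ht'⟩
      succ_notMem := fun t ht => ht.2
      exists_extends := fun t _ n ⟨_, s, hs, hts⟩ =>
        let ⟨t', ht', hst'⟩ := hext s hs
        ⟨t', ht', hts.trans hst'⟩ }
  exact ⟨q, ⟨fun t ht => ht.1, fun t _ n hn => hn.1.1⟩, fun t _ n hn => hn.1.2⟩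

open OrdinalApprox in
theorem thin_of_forall_notMem_gfp_derivative (h : ∀ t ∈ p.nodes, t ∉ (p.derivative U).gfp) :
    p.Thin U := by
  let D : Ordinal → Set (List ℕ) := gfpApprox (p.derivative U) ⊤
  let rank : List ℕ → Ordinal := fun t => sInf {α | t ∉ p.derivative U (D α)}
  have hrank : ∀ t ∈ p.nodes, t ∉ p.derivative U (D (rank t)) := by
    intro t ht
    obtain ⟨α, hα⟩ := gfp_mem_range_gfpApprox (p.derivative U)
    refine csInf_mem (s := {α | t ∉ p.derivative U (D α)}) ⟨α, ?_⟩
    change t ∉ p.derivative U (gfpApprox (p.derivative U) ⊤ α)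
    rw [hα, OrderHom.map_gfp]
    exact h t ht
  have hmem : ∀ t, t ∈ D (rank t) := by
    intro t
    simp only [D]
    rw [gfpApprox]
    simp only [mem_iInter, Set.inf_eq_inter, Set.top_eq_univ, univ_inter, iInf_eq_iInter]
    exact fun β hβ => not_not.1 fun hcon => notMem_of_lt_csInf' hβ hcon
  refine ⟨fun t => p.succInto U (D (rank t)) t, fun t ht => not_not.1 fun hpos =>
    hrank t ht ⟨t, ht, List.prefix_rfl, hpos⟩, fun t n htn => ?_⟩
  have hanti : Antitone (rank ∘ t) := antitone_nat_of_succ_le fun k => csInf_le' fun hcon =>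
    hrank (t k) (htn k).1 (mem_derivative_of_isPrefix (htn.prefix_succ k) hcon)
  obtain ⟨m, hm⟩ := WellFoundedLT.antitone_chain_condition hanti
  filter_upwards [eventually_ge_atTop m] with k hk hnU
  have heq : rank (t k) = rank (t (k + 1)) := (hm k hk).symm.trans (hm (k + 1) (by lia))
  exact ⟨⟨(htn k).2.1, hnU⟩, t (k + 1), heq ▸ hmem _, (htn k).2.2⟩

theorem thin_or_exists_le (p : Skeleton J) (U : Set ℕ) :
    p.Thin U ∨ ∃ q ≤ p, ∀ t ∈ q.nodes, q.succ t ⊆ U := by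
  by_cases h : ∀ t ∈ p.nodes, t ∉ (p.derivative U).gfp
  · exact Or.inl (thin_of_forall_notMem_gfp_derivative h)
  · push Not at h
    obtain ⟨t, -, ht⟩ := h
    exact Or.inr (exists_le_of_mem_gfp_derivative ht)

end Thin

end Skeleton

section SplitsSkeletons

/-- The cardinality of `K` is below the bounding number: every family of functions indexed by `K`
is bounded modulo finite sets. -/
def IsBelowBounding (K : Type*) : Prop :=
  ∀ h : K → ℕ → ℕ, ∃ H : ℕ → ℕ, ∀ b, ∀ᶠ n in atTop, h b n ≤ H n

theorem IsBelowBounding.exists_bound {K σ : Type*} [Countable σ] (hK : IsBelowBounding K)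
    (h : K → σ → ℕ) : ∃ H : σ → ℕ, ∀ b, ∀ᶠ a in cofinite, h b a ≤ H a := by
  obtain ⟨e, he⟩ := Countable.exists_injective_nat σ
  obtain ⟨H, hH⟩ := hK fun b => Function.extend e (h b) 0
  refine ⟨H ∘ e, fun b => ?_⟩
  filter_upwards [he.tendsto_cofinite.eventually (Nat.cofinite_eq_atTop ▸ hH b)] with a ha
  rwa [he.extend_apply] at ha

theorem IsBelowBounding.exists_selection {K σ : Type*} [Countable σ] (hK : IsBelowBounding K)
    {A : Set (Set ℕ)} (hA : IsAD A) {X : σ → Set ℕ} (hX : ∀ a, X a ∉ generatedIdeal A)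
    {N : K → σ → Set ℕ} (hN : ∀ b a, N b a ∈ generatedIdeal A) (l : σ → ℕ) :
    ∃ n : σ → ℕ, (∀ a, n a ∈ X a ∧ l a < n a) ∧ ∀ b, ∀ᶠ a in cofinite, n a ∉ N b a := by
  choose Y hY hYpos using fun a => hA.exists_seq_of_notMem_generatedIdeal (hX a)
  have hfin : ∀ b a, ∃ m₀, ∀ m ≥ m₀, (N b a ∩ Y a m).Finite := fun b a => by
    rw [← eventually_atTop, ← Nat.cofinite_eq_atTop]
    exact not_not.1 fun hinf => hYpos a _ hinf (hN b a)
  choose h₁ hh₁ using hfin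
  obtain ⟨H₁, hH₁⟩ := hK.exists_bound h₁
  obtain ⟨H₂, hH₂⟩ := hK.exists_bound fun b a => sSup (N b a ∩ Y a (H₁ a))
  choose n hnY hn using fun a => (hY a (H₁ a)).1.exists_gt (max (l a) (H₂ a))
  refine ⟨n, fun a => ⟨(hY a _).2 (hnY a), (le_max_left _ _).trans_lt (hn a)⟩, fun b => ?_⟩
  filter_upwards [hH₁ b, hH₂ b] with a ha₁ ha₂ hnN
  have hle := le_csSup (hh₁ b a _ ha₁).bddAbove ⟨hnN, hnY a⟩
  exact (hle.trans ha₂).not_gt ((le_max_right _ _).trans_lt (hn a))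

/-- For every skeleton of sets positive for an almost disjoint family, some member of `S` is such
that the skeleton is thin in neither of its sides. -/
def SplitsSkeletons {K : Type*} (S : K → Set ℕ) : Prop :=
  ∀ A, IsAD A → ∀ p : Skeleton (generatedIdeal A), ∃ b, ∀ c, ¬p.Thin (side (S b) c)

theorem IsOmegaSplitting.splitsSkeletons {K : Type*} {S : K → Set ℕ} (hS : IsOmegaSplitting S) :
    SplitsSkeletons S := by
  intro A hA p
  choose Y hY hYpos using fun t : p.nodes =>
    hA.exists_seq_of_notMem_generatedIdeal (p.succ_notMem t t.2)
  have : Nonempty p.nodes := p.nonempty.to_subtype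
  obtain ⟨e, he⟩ := exists_surjective_nat (p.nodes × ℕ)
  obtain ⟨b, hb⟩ := hS (fun k => Y (e k).1 (e k).2) fun k => (hY _ _).1
  refine ⟨b, fun c => Skeleton.not_thin_of_notMem fun t ht => hYpos ⟨t, ht⟩ _ ?_⟩
  refine infinite_univ.mono fun m _ => ?_
  obtain ⟨k, hk⟩ := he (⟨t, ht⟩, m)
  have hkc := (hb k).infinite_inter_side c
  rw [hk] at hkc
  exact hkc.mono fun x hx => ⟨⟨(hY _ m).2 hx.1, hx.2⟩, hx.1⟩

theorem IsBelowBounding.splitsSkeletons {K : Type*} (hK : IsBelowBounding K) {S : K → Set ℕ}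
    (hS : ∀ X : Set ℕ, X.Infinite → ∃ b, Splits (S b) X) : SplitsSkeletons S := by
  intro A hA p
  by_contra! hthin
  choose c N hN using hthin
  -- Choosing successors above the sum of their node makes them increase along every path.
  obtain ⟨n, hn, hnN⟩ := hK.exists_selection hA (X := fun t : p.nodes => p.succ t)
    (fun t => p.succ_notMem t t.2) (N := fun b t => N b t) (fun b t => (hN b).1 t t.2)
    fun t => t.1.sum
  obtain ⟨t, ht⟩ := p.exists_isPath fun t => (hn t).1
  have hmono : StrictMono fun k => n (t k) := strictMono_nat_of_lt_succ fun k =>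
    (List.le_sum_of_mem ((ht k).2.2.subset (by simp))).trans_lt (hn (t (k + 1))).2
  obtain ⟨b, hb⟩ := hS (range fun k => n (t k)) (infinite_range_of_injective hmono.injective)
  refine hb.infinite_inter_side (c b) ?_
  have ht_inj : Function.Injective t := Function.Injective.of_comp (f := Subtype.val) ht.injective
  have hev := ((hN b).2 _ _ ht).and
    (Nat.cofinite_eq_atTop ▸ ht_inj.tendsto_cofinite.eventually (hnN b))
  obtain ⟨k₀, hk₀⟩ := eventually_atTop.1 hev
  refine ((finite_Iio k₀).image fun k => n (t k)).subset ?_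
  rintro _ ⟨⟨k, rfl⟩, hk⟩
  exact ⟨k, not_le.1 fun hle => (hk₀ k hle).2 ((hk₀ k hle).1 hk), rfl⟩

theorem exists_splitsSkeletons {K : Type} (hK : #K = splittingNumber) :
    ∃ S : K → Set ℕ, SplitsSkeletons S := by
  obtain ⟨𝒮, h𝒮, hcard⟩ := exists_isSplittingFamily_mk_eq
  obtain ⟨e⟩ := Cardinal.eq.1 (hK.trans hcard.symm)
  have hS : ∀ X : Set ℕ, X.Infinite → ∃ b, Splits (e b : Set ℕ) X := fun X hX =>
    let ⟨S, hS, hSX⟩ := h𝒮.2 X hX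
    ⟨e.symm ⟨S, hS⟩, by rwa [e.apply_symm_apply]⟩
  by_cases hbdd : IsBelowBounding K
  · exact ⟨_, hbdd.splitsSkeletons hS⟩
  · simp only [IsBelowBounding, not_forall, not_exists, not_eventually, not_le] at hbdd
    obtain ⟨f, hf⟩ := hbdd
    have hKK : #K = #(K × K) := by
      rw [mk_prod, lift_id, mul_eq_self (hK ▸ aleph0_le_splittingNumber)]
    obtain ⟨p⟩ := Cardinal.eq.1 hKK
    have hω := isOmegaSplitting_blockSet hf hS
    refine ⟨fun b => blockSet (orbit (f (p b).1)) (e (p b).2),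
      IsOmegaSplitting.splitsSkeletons fun X hX => ?_⟩
    obtain ⟨b, hb⟩ := hω X hX
    exact ⟨p.symm b, by simpa only [p.apply_symm_apply] using hb⟩

theorem SplitsSkeletons.exists_forall_inter_side_notMem {K : Type*} {S : K → Set ℕ}
    (hS : SplitsSkeletons S) {A : Set (Set ℕ)} (hA : IsAD A) {X : Set ℕ}
    (hX : X ∉ generatedIdeal A) : ∃ b, ∀ c, X ∩ side (S b) c ∉ generatedIdeal A := by
  let p : Skeleton (generatedIdeal A) :=
    { nodes := univ
      succ := fun _ => X
      nonempty := univ_nonempty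
      succ_notMem := fun _ _ => hX
      exists_extends := fun t _ n _ => ⟨t ++ [n], trivial, List.prefix_rfl⟩ }
  obtain ⟨b, hb⟩ := hS A hA p
  exact ⟨b, fun c hc => hb c ⟨fun _ => X ∩ side (S b) c, fun _ _ => hc,
    fun _ _ htn => Eventually.of_forall fun k hk => ⟨(htn k).2.1, hk⟩⟩⟩

end SplitsSkeletons

/-- A node of the binary tree `2^{<K}`: the sequence of signs `sign b` for `b < length`. The other
values of `sign` carry no information. -/
structure Node (K : Type*) where
  length : K
  sign : K → Bool

namespace Node

variable {K : Type*} [LinearOrder K] {σ σ' τ τ' : Node K}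

/-- `σ ≤ τ` if `σ` is an initial segment of `τ`. This is not antisymmetric, because of the
irrelevant values of `sign`. -/
instance : Preorder (Node K) where
  le σ τ := σ.length ≤ τ.length ∧ ∀ b < σ.length, σ.sign b = τ.sign b
  le_refl _ := ⟨le_rfl, fun _ _ => rfl⟩
  le_trans _ _ _ h h' :=
    ⟨h.1.trans h'.1, fun b hb => (h.2 b hb).trans (h'.2 b (hb.trans_le h.1))⟩

/-- Two nodes are incompatible if they branch off at some common position. -/
def Incompatible (σ τ : Node K) : Prop :=
  ∃ b, b < σ.length ∧ b < τ.length ∧ σ.sign b ≠ τ.sign b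

theorem Incompatible.mono (h : σ.Incompatible τ) (hσ : σ ≤ σ') (hτ : τ ≤ τ') :
    σ'.Incompatible τ' := by
  obtain ⟨b, hbσ, hbτ, hne⟩ := h
  exact ⟨b, hbσ.trans_le hσ.1, hbτ.trans_le hτ.1, hσ.2 b hbσ ▸ hτ.2 b hbτ ▸ hne⟩

theorem not_incompatible_self : ¬σ.Incompatible σ := fun ⟨_, _, _, hne⟩ => hne rfl

theorem le_or_le_or_incompatible (σ τ : Node K) : σ ≤ τ ∨ τ ≤ σ ∨ σ.Incompatible τ := by
  by_cases h : σ.Incompatible τ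
  · exact Or.inr (Or.inr h)
  · simp only [Incompatible, not_exists, not_and, not_not] at h
    rcases le_total σ.length τ.length with hle | hle
    · exact Or.inl ⟨hle, fun b hb => h b hb (hb.trans_le hle)⟩
    · exact Or.inr (Or.inl ⟨hle, fun b hb => (h b (hb.trans_le hle) hb).symm⟩)

theorem exists_forall_lt_of_undecided [WellFoundedLT K] {Small : K → Bool → Prop}
    (h : ∃ b, ∀ c, ¬Small b c) :
    ∃ ν : Node K, (∀ b < ν.length, Small b (!ν.sign b)) ∧ ∀ c, ¬Small ν.length c := by
  obtain ⟨b, hb, hmin⟩ := WellFounded.has_min wellFounded_lt {b | ∀ c, ¬Small b c} h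
  have hdec : ∀ a, ∃ c, a < b → Small a (!c) := fun a => by
    by_contra! hcon
    exact hmin a (fun c => by simpa using (hcon !c).2) (hcon true).1
  choose sign hsign using hdec
  exact ⟨⟨b, sign⟩, hsign, hb⟩

end Node

section LabelledAD

variable {K : Type} [LinearOrder K] {S : K → Set ℕ} {D : Set (Set ℕ)}
  {G : Set (Set ℕ × Node K)} {X Y : Set ℕ} {ν σ τ : Node K}

/-- `X` is almost contained in the sides of the sets `S b` that are prescribed by `ν`. -/
def FollowsNode (S : K → Set ℕ) (X : Set ℕ) (ν : Node K) : Prop :=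
  ∀ b < ν.length, (X \ side (S b) (ν.sign b)).Finite

theorem FollowsNode.finite_inter (hX : FollowsNode S X σ) (hY : FollowsNode S Y τ)
    (h : σ.Incompatible τ) : (X ∩ Y).Finite := by
  obtain ⟨b, hσ, hτ, hne⟩ := h
  have hYb := hY b hτ
  rw [← Bool.not_eq.2 hne, side_not] at hYb
  refine ((hX b hσ).union hYb).subset fun n hn => ?_
  by_cases hnb : n ∈ side (S b) (σ.sign b)
  · exact Or.inr ⟨hn.2, not_not.2 hnb⟩
  · exact Or.inl ⟨hn.1, hnb⟩

/-- An almost disjoint family of members of `D` whose members `X` are labelled by distinct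
nodes which they follow. -/
structure IsLabelledAD (S : K → Set ℕ) (D : Set (Set ℕ)) (G : Set (Set ℕ × Node K)) : Prop where
  infinite : ∀ x ∈ G, x.1.Infinite
  mem : ∀ x ∈ G, x.1 ∈ D
  follows : ∀ x ∈ G, FollowsNode S x.1 x.2
  finite_inter : G.Pairwise fun x y => (x.1 ∩ y.1).Finite
  not_equiv : G.Pairwise fun x y => ¬(x.2 ≤ y.2 ∧ y.2 ≤ x.2)

namespace IsLabelledAD

theorem empty : IsLabelledAD S D ∅ := by
  constructor <;> simp

theorem sUnion {𝒢 : Set (Set (Set ℕ × Node K))} (hchain : IsChain (· ⊆ ·) 𝒢)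
    (h : ∀ G ∈ 𝒢, IsLabelledAD S D G) : IsLabelledAD S D (⋃₀ 𝒢) where
  infinite := fun x ⟨G, hG, hx⟩ => (h G hG).infinite x hx
  mem := fun x ⟨G, hG, hx⟩ => (h G hG).mem x hx
  follows := fun x ⟨G, hG, hx⟩ => (h G hG).follows x hx
  finite_inter := (pairwise_sUnion hchain.directedOn).2 fun G hG => (h G hG).finite_inter
  not_equiv := (pairwise_sUnion hchain.directedOn).2 fun G hG => (h G hG).not_equiv

theorem injOn_fst (hG : IsLabelledAD S D G) : InjOn Prod.fst G := fun x hx y hy hxy => by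
  by_contra hne
  have hfin : (x.1 ∩ y.1).Finite := hG.finite_inter hx hy hne
  rw [hxy, inter_self] at hfin
  exact hG.infinite y hy hfin

theorem isAD (hG : IsLabelledAD S D G) : IsAD (Prod.fst '' G) :=
  ⟨forall_mem_image.2 hG.infinite,
    hG.injOn_fst.pairwise_image.2 hG.finite_inter⟩

theorem union_range (hG : IsLabelledAD S D G) {ι : Type*} {Z : ι → Set ℕ} {ν : ι → Node K}
    (hinf : ∀ i, (Z i).Infinite) (hmem : ∀ i, Z i ∈ D) (hfol : ∀ i, FollowsNode S (Z i) (ν i))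
    (hν : Pairwise fun i j => (ν i).Incompatible (ν j))
    (hZG : ∀ i, ∀ y ∈ G, (Z i ∩ y.1).Finite) (hνG : ∀ i, ∀ y ∈ G, ¬ν i ≤ y.2) :
    IsLabelledAD S D (G ∪ range fun i => (Z i, ν i)) where
  infinite := union_subset hG.infinite (range_subset_iff.2 hinf)
  mem := union_subset hG.mem (range_subset_iff.2 hmem)
  follows := union_subset hG.follows (range_subset_iff.2 hfol)
  finite_inter := by
    refine pairwise_union.2 ⟨hG.finite_inter, ?_, ?_⟩
    · rintro _ ⟨i, rfl⟩ _ ⟨j, rfl⟩ hij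
      exact (hfol i).finite_inter (hfol j) (hν fun h => hij (h ▸ rfl))
    · rintro y hy _ ⟨i, rfl⟩ -
      exact ⟨inter_comm y.1 (Z i) ▸ hZG i y hy, hZG i y hy⟩
  not_equiv := by
    refine pairwise_union.2 ⟨hG.not_equiv, ?_, ?_⟩
    · rintro _ ⟨i, rfl⟩ _ ⟨j, rfl⟩ hij hle
      have hinc : (ν i).Incompatible (ν j) := hν fun h => hij (h ▸ rfl)
      exact Node.not_incompatible_self (hinc.mono hle.1 le_rfl)
    · rintro y hy _ ⟨i, rfl⟩ -
      exact ⟨fun hle => hνG i y hy hle.2, fun hle => hνG i y hy hle.1⟩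

theorem mk_setOf_le_lt (hG : IsLabelledAD S D G) [NoMaxOrder K] {κ : Cardinal.{0}}
    (hK : ∀ b : K, #(Iio b) < κ) (ν : Node K) : #{x ∈ G | x.2 ≤ ν} < κ := by
  obtain ⟨c, hc⟩ := exists_gt ν.length
  refine lt_of_le_of_lt (mk_le_of_injective (f := fun x : {x ∈ G | x.2 ≤ ν} =>
    (⟨x.1.2.length, x.2.2.1.trans_lt hc⟩ : Iio c)) ?_) (hK c)
  rintro ⟨x, hx, hxν⟩ ⟨y, hy, hyν⟩ hxy
  have hlen : x.2.length = y.2.length := congrArg Subtype.val hxy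
  refine Subtype.ext (by_contra fun hne => hG.not_equiv hx hy hne ⟨⟨hlen.le, fun b hb => ?_⟩,
    ⟨hlen.ge, fun b hb => ?_⟩⟩)
  · rw [hxν.2 b hb, hyν.2 b (hlen ▸ hb)]
  · rw [hxν.2 b (hlen ▸ hb), hyν.2 b hb]

end IsLabelledAD

/-- The indices of the sets which an infinite set must be almost disjoint from when it is meant
to follow the node `ν`: a position `b < ν.length` stands for a set deciding `S b`, and a labelled
set whose label is an initial segment of `ν` stands for itself. -/
def obstacles (G : Set (Set ℕ × Node K)) (ν : Node K) : Set (K ⊕ Set ℕ × Node K) :=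
  Sum.inl '' Iio ν.length ∪ Sum.inr '' {x ∈ G | x.2 ≤ ν}

theorem IsLabelledAD.mk_obstacles_lt (hG : IsLabelledAD S D G) [NoMaxOrder K] {κ : Cardinal.{0}}
    (hκ : ℵ₀ ≤ κ) (hK : ∀ b : K, #(Iio b) < κ) (ν : Node K) : #(obstacles G ν) < κ :=
  (mk_union_le _ _).trans_lt <| add_lt_of_lt hκ (mk_image_le.trans_lt (hK _))
    (mk_image_le.trans_lt (hG.mk_setOf_le_lt hK ν))

theorem IsLabelledAD.exists_infinite_subset_forall_obstacles (hG : IsLabelledAD S D G)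
    (hcard : #(obstacles G ν) < almostDisjointnessNumber) {B : K → Set ℕ}
    (hB : ∀ b < ν.length, B b ∈ generatedIdeal (Prod.fst '' G))
    (hY : Y ∉ generatedIdeal (Prod.fst '' G)) :
    ∃ Z ⊆ Y, Z.Infinite ∧ ∀ i ∈ obstacles G ν, (Z ∩ Sum.elim B Prod.fst i).Finite := by
  have hmem : ∀ i : obstacles G ν, Sum.elim B Prod.fst i.1 ∈ generatedIdeal (Prod.fst '' G) := by
    rintro ⟨_, ⟨b, hb, rfl⟩ | ⟨x, hx, rfl⟩⟩
    · exact hB b hb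
    · exact mem_generatedIdeal_of_mem (mem_image_of_mem _ hx.1)
  obtain ⟨Z, hZY, hZ, hfin⟩ :=
    hG.isAD.exists_infinite_subset_forall_mem_generatedIdeal hcard hmem hY
  exact ⟨Z, hZY, hZ, fun i hi => hfin ⟨i, hi⟩⟩

end LabelledAD

section Decision

variable {K : Type*} [LinearOrder K] {S : K → Set ℕ} {A : Set (Set ℕ)} {X Y Z : Set ℕ}
  {ν ν' : Node K}

/-- Modulo the ideal `I`, the set `Y` is decided by `S b` to lie on the side `ν.sign b` for all
`b < ν.length`, and it is split by `S ν.length`. -/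
structure IsDecisionNode (I : Order.Ideal (Set ℕ)) (S : K → Set ℕ) (Y : Set ℕ) (ν : Node K) :
    Prop where
  mem : ∀ b < ν.length, Y ∩ side (S b) (!ν.sign b) ∈ I
  notMem : ∀ c, Y ∩ side (S ν.length) c ∉ I

theorem SplitsSkeletons.exists_isDecisionNode [WellFoundedLT K] (hS : SplitsSkeletons S)
    (hA : IsAD A) (hY : Y ∉ generatedIdeal A) : ∃ ν, IsDecisionNode (generatedIdeal A) S Y ν :=
  let ⟨ν, hmem, hnotMem⟩ :=
    Node.exists_forall_lt_of_undecided (hS.exists_forall_inter_side_notMem hA hY)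
  ⟨ν, hmem, hnotMem⟩

theorem IsDecisionNode.notMem_ideal {I : Order.Ideal (Set ℕ)} (hν : IsDecisionNode I S Y ν) :
    Y ∉ I :=
  fun h => hν.notMem true (I.lower inter_subset_left h)

theorem IsDecisionNode.length_lt_and_sign_eq (hν : IsDecisionNode (generatedIdeal A) S Y ν)
    (hν' : IsDecisionNode (generatedIdeal A) S Z ν') {c : Bool}
    (hZ : (Z \ (Y ∩ side (S ν.length) c)).Finite) :
    ν.length < ν'.length ∧ ν'.sign ν.length = c := by
  have hlt : ν.length < ν'.length := by
    by_contra! hle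
    rcases hle.lt_or_eq with hlt | heq
    · exact hν'.notMem _ (mem_generatedIdeal_of_finite_sdiff (hν.mem _ hlt)
        (hZ.subset fun n hn => ⟨hn.1.1, fun h => hn.2 ⟨h.1, hn.1.2⟩⟩))
    · refine hν'.notMem (!c) (mem_generatedIdeal_of_finite (hZ.subset fun n hn => ⟨hn.1, ?_⟩))
      rw [side_not, heq] at hn
      exact fun h => hn.2 h.2
  refine ⟨hlt, by_contra fun hne => hν'.notMem_ideal ?_⟩
  have hmem := hν'.mem _ hlt
  rw [Bool.not_eq.2 hne] at hmem
  exact mem_generatedIdeal_of_finite_sdiff hmem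
    (hZ.subset fun n hn => ⟨hn.1, fun h => hn.2 ⟨hn.1, h.2⟩⟩)

-- Splitting repeatedly yields a perfect tree of positive sets. Each of its branches has a positive
-- pseudointersection, whose decision node extends all the decisions made along the branch.
theorem SplitsSkeletons.exists_incompatible_isDecisionNode [WellFoundedLT K]
    (hS : SplitsSkeletons S) (hA : IsAD A) (hX : X ∉ generatedIdeal A) :
    ∃ (Z : (ℕ → Bool) → Set ℕ) (ν : (ℕ → Bool) → Node K),
      (∀ x, Z x ⊆ X ∧ IsDecisionNode (generatedIdeal A) S (Z x) (ν x)) ∧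
        Pairwise fun x y => (ν x).Incompatible (ν y) := by
  have hdec : ∀ Y : {Y // Y ∉ generatedIdeal A}, ∃ ν, IsDecisionNode (generatedIdeal A) S Y ν :=
    fun Y => hS.exists_isDecisionNode hA Y.2
  choose μ hμ using hdec
  let T : List Bool → {Y // Y ∉ generatedIdeal A} := fun l =>
    l.rec ⟨X, hX⟩ fun c _ Y => ⟨Y ∩ side (S (μ Y).length) c, (hμ Y).notMem c⟩
  have hZ : ∀ x : ℕ → Bool, ∃ Z ∉ generatedIdeal A, Z ⊆ X ∧
      ∀ k, (Z \ (T (PiNat.res x k)).1).Finite := fun x =>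
    hA.exists_pseudointersection (Y := fun k => (T (PiNat.res x k)).1)
      (fun k => (T (PiNat.res x k)).2) (antitone_nat_of_succ_le fun k => inter_subset_left)
  choose Z hZ hZX hZT using hZ
  have hν : ∀ x, ∃ ν, IsDecisionNode (generatedIdeal A) S (Z x) ν := fun x =>
    hS.exists_isDecisionNode hA (hZ x)
  choose ν hν using hν
  have hlt : ∀ x k, (μ (T (PiNat.res x k))).length < (ν x).length ∧
      (ν x).sign (μ (T (PiNat.res x k))).length = x k := fun x k =>
    (hμ _).length_lt_and_sign_eq (hν x) (hZT x (k + 1))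
  refine ⟨Z, ν, fun x => ⟨hZX x, hν x⟩, fun x y hxy => ?_⟩
  have hx := hlt x (PiNat.firstDiff x y)
  have hy := hlt y (PiNat.firstDiff x y)
  have hres : PiNat.res x (PiNat.firstDiff x y) = PiNat.res y (PiNat.firstDiff x y) :=
    PiNat.res_eq_res.2 fun i hi => PiNat.apply_eq_of_lt_firstDiff hi
  rw [← hres] at hy
  exact ⟨_, hx.1, hy.1, by rw [hx.2, hy.2]; exact PiNat.apply_firstDiff_ne hxy⟩

end Decision

section Extension

theorem infinite_setOf_forall_not {α β : Type u} [Infinite α] {G : Set β} (hG : #G < #α)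
    {R : β → α → Prop} (hR : ∀ y ∈ G, ∀ x x', R y x → R y x' → x = x') :
    {x | ∀ y ∈ G, ¬R y x}.Infinite := by
  have hbad : #{x | ∃ y ∈ G, R y x} ≤ #G := by
    have hy : ∀ x : {x | ∃ y ∈ G, R y x}, ∃ y : G, R y x := fun ⟨_, y, hy, h⟩ => ⟨⟨y, hy⟩, h⟩
    choose y hy using hy
    exact mk_le_of_injective (f := y) fun x x' h =>
      Subtype.ext (hR _ (y x).2 _ _ (hy x) (h ▸ hy x'))
  have hcompl : {x | ∀ y ∈ G, ¬R y x} = {x | ∃ y ∈ G, R y x}ᶜ := by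
    ext
    simp
  rw [hcompl, ← infinite_coe_iff, infinite_iff, mk_compl_of_infinite _ (hbad.trans_lt hG)]
  exact aleph0_le_mk α

/-- `D` is dense in the infinite subsets of `ω`, ordered by inclusion. -/
def IsDenseFamily (D : Set (Set ℕ)) : Prop :=
  ∀ X : Set ℕ, X.Infinite → ∃ Y ∈ D, Y.Infinite ∧ Y ⊆ X

theorem IsTall.isDenseFamily {I : Order.Ideal (Set ℕ)} (hI : IsTall I) :
    IsDenseFamily (I : Set (Set ℕ)) := fun X hX =>
  let ⟨Y, hY, hXY⟩ := hI X hX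
  ⟨X ∩ Y, I.lower inter_subset_right hY, hXY, inter_subset_left⟩

namespace IsLabelledAD

variable {K : Type} [LinearOrder K] [NoMaxOrder K] {S : K → Set ℕ} {D : Set (Set ℕ)}
  {G : Set (Set ℕ × Node K)} {X : Set ℕ} {ν : Node K}

theorem exists_followsNode_subset (hG : IsLabelledAD S D G) (hD : IsDenseFamily D)
    (hK : ∀ b : K, #(Iio b) < almostDisjointnessNumber)
    (hν : IsDecisionNode (generatedIdeal (Prod.fst '' G)) S X ν) :
    ∃ Z ∈ D, Z ⊆ X ∧ Z.Infinite ∧ FollowsNode S Z ν ∧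
      ∀ y ∈ G, y.2 ≤ ν → (Z ∩ y.1).Finite := by
  have hcard := hG.mk_obstacles_lt (aleph0_le_almostDisjointnessNumber (hK ν.length)) hK ν
  obtain ⟨W, hWX, hW, hWfin⟩ :=
    hG.exists_infinite_subset_forall_obstacles hcard hν.mem hν.notMem_ideal
  obtain ⟨Z, hZD, hZ, hZW⟩ := hD W hW
  refine ⟨Z, hZD, hZW.trans hWX, hZ, fun b hb => ?_, fun y hy hyν => ?_⟩
  · refine (hWfin (Sum.inl b) (Or.inl (mem_image_of_mem _ hb))).subset fun n hn => ?_
    rw [Sum.elim_inl, side_not]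
    exact ⟨hZW hn.1, hWX (hZW hn.1), hn.2⟩
  · exact (hWfin (Sum.inr y) (Or.inr (mem_image_of_mem _ ⟨hy, hyν⟩))).subset
      (inter_subset_inter_left _ hZW)

theorem exists_extension [WellFoundedLT K] (hG : IsLabelledAD S D G) (hD : IsDenseFamily D)
    (hK : ∀ b : K, #(Iio b) < almostDisjointnessNumber) (hS : SplitsSkeletons S)
    (hcard : #G < 𝔠) (hX : X ∉ generatedIdeal (Prod.fst '' G)) :
    ∃ N : Set (Set ℕ × Node K), N.Countable ∧ N.Infinite ∧ IsLabelledAD S D (G ∪ N) ∧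
      ∀ y ∈ N, y.1 ⊆ X := by
  obtain ⟨Y, ν, hY, hν⟩ := hS.exists_incompatible_isDecisionNode hG.isAD hX
  have hfree : {x | ∀ y ∈ G, ¬ν x ≤ y.2}.Infinite := by
    refine infinite_setOf_forall_not (by simpa using hcard) fun y _ x x' hx hx' => ?_
    by_contra hne
    exact Node.not_incompatible_self ((hν hne).mono hx hx')
  let e := hfree.natEmbedding
  have hZ : ∀ i, ∃ Z ∈ D, Z ⊆ Y (e i) ∧ Z.Infinite ∧ FollowsNode S Z (ν (e i)) ∧
      ∀ y ∈ G, y.2 ≤ ν (e i) → (Z ∩ y.1).Finite := fun i =>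
    hG.exists_followsNode_subset hD hK (hY (e i)).2
  choose Z hZD hZY hZ hZν hZG using hZ
  have he : Pairwise fun i j => (ν (e i)).Incompatible (ν (e j)) := fun i j hij =>
    hν fun h => hij (e.injective (Subtype.ext h))
  refine ⟨range fun i => (Z i, ν (e i)), countable_range _, infinite_range_of_injective ?_,
    hG.union_range hZ hZD hZν he (fun i y hy => ?_) fun i => (e i).2,
    forall_mem_range.2 fun i => (hZY i).trans (hY (e i)).1⟩
  · refine fun i j hij => by_contra fun hne => ?_
    have hinc : (ν (e i)).Incompatible (ν (e j)) := he hne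
    rw [show ν (e i) = ν (e j) from (Prod.ext_iff.1 hij).2] at hinc
    exact Node.not_incompatible_self hinc
  · rcases Node.le_or_le_or_incompatible (ν (e i)) y.2 with h | h | h
    · exact absurd h ((e i).2 y hy)
    · exact hZG i y hy h
    · exact (hZν i).finite_inter (hG.follows y hy) h

end IsLabelledAD

end Extension

section DecidedSkeleton

variable {K : Type*} [LinearOrder K] {S : K → Set ℕ} {J : Order.Ideal (Set ℕ)}

namespace Skeleton

theorem exists_le_forall_isPrefix (p : Skeleton J) {t : List ℕ} (ht : t ∈ p.nodes) {n : ℕ}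
    (hn : n ∈ p.succ t) : ∃ q ≤ p, ∀ s ∈ q.nodes, t ++ [n] <+: s := by
  let q : Skeleton J :=
    { nodes := {s ∈ p.nodes | t ++ [n] <+: s}
      succ := p.succ
      nonempty := p.exists_extends t ht n hn
      succ_notMem := fun s hs => p.succ_notMem s hs.1
      exists_extends := fun s hs m hm =>
        let ⟨s', hs', hss'⟩ := p.exists_extends s hs.1 m hm
        ⟨s', ⟨hs', hs.2.trans ((List.prefix_append _ _).trans hss')⟩, hss'⟩ }
  exact ⟨q, ⟨sep_subset _ _, fun _ _ => subset_rfl⟩, fun s hs => hs.2⟩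

end Skeleton

/-- A skeleton with a node such that, for every `b < node.length`, the skeleton is thin on the side
of `S b` that is opposite to `node.sign b`, as witnessed by the sets `null b`. It is a condition
in the fusion that constructs positive branches. -/
structure DecidedSkeleton (S : K → Set ℕ) (J : Order.Ideal (Set ℕ)) where
  skel : Skeleton J
  node : Node K
  null : K → List ℕ → Set ℕ
  thin : ∀ b < node.length, skel.ThinBy (side (S b) (!node.sign b)) (null b)

namespace DecidedSkeleton

/-- `q ≤ p` if `q` is stronger than `p` and keeps its witnesses. -/
instance : Preorder (DecidedSkeleton S J) where
  le q p := q.skel ≤ p.skel ∧ p.node ≤ q.node ∧ ∀ b < p.node.length, q.null b = p.null b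
  le_refl _ := ⟨le_rfl, le_rfl, fun _ _ => rfl⟩
  le_trans _ _ _ h h' := ⟨h.1.trans h'.1, h'.2.1.trans h.2.1, fun b hb =>
    (h.2.2 b (hb.trans_le h'.2.1.1)).trans (h'.2.2 b hb)⟩

theorem exists_le_forall_isPrefix (p : DecidedSkeleton S J) {t : List ℕ} (ht : t ∈ p.skel.nodes)
    {n : ℕ} (hn : n ∈ p.skel.succ t) : ∃ q ≤ p, ∀ s ∈ q.skel.nodes, t ++ [n] <+: s := by
  obtain ⟨q, hqp, hq⟩ := p.skel.exists_le_forall_isPrefix ht hn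
  exact ⟨{ p with skel := q, thin := fun b hb => (p.thin b hb).anti hqp },
    ⟨hqp, le_rfl, fun _ _ => rfl⟩, hq⟩

theorem exists_le_of_thin (p : DecidedSkeleton S J) {q : Skeleton J} (hq : q ≤ p.skel)
    {μ : Node K} (hμ : p.node ≤ μ) (hthin : ∀ b < μ.length, q.Thin (side (S b) (!μ.sign b))) :
    ∃ r ≤ p, r.skel = q ∧ r.node = μ := by
  have hnull : ∀ b, ∃ N, (b < μ.length → q.ThinBy (side (S b) (!μ.sign b)) N) ∧
      (b < p.node.length → N = p.null b) := by
    intro b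
    by_cases hb : b < p.node.length
    · exact ⟨p.null b, fun _ => hμ.2 b hb ▸ (p.thin b hb).anti hq, fun _ => rfl⟩
    · by_cases hbμ : b < μ.length
      · obtain ⟨N, hN⟩ := hthin b hbμ
        exact ⟨N, fun _ => hN, fun h => absurd h hb⟩
      · exact ⟨p.null b, fun h => absurd h hbμ, fun _ => rfl⟩
  choose N hN hNp using hnull
  exact ⟨⟨q, μ, N, hN⟩, ⟨hq, hμ, hNp⟩, rfl, rfl⟩

variable [WellFoundedLT K] {A : Set (Set ℕ)}

theorem exists_skel_eq (hS : SplitsSkeletons S) (hA : IsAD A) (p : Skeleton (generatedIdeal A)) :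
    ∃ q : DecidedSkeleton S (generatedIdeal A), q.skel = p := by
  obtain ⟨ν, hν, -⟩ := Node.exists_forall_lt_of_undecided (hS A hA p)
  choose! N hN using hν
  exact ⟨⟨p, ν, N, hN⟩, rfl⟩

theorem exists_node_ge (hS : SplitsSkeletons S) (hA : IsAD A)
    (p : DecidedSkeleton S (generatedIdeal A)) :
    ∃ ν ≥ p.node, (∀ b < ν.length, p.skel.Thin (side (S b) (!ν.sign b))) ∧
      ∀ c, ¬p.skel.Thin (side (S ν.length) c) := by
  have hundec : ∃ b, ∀ c, ¬(p.skel.Thin (side (S b) c) ∧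
      (b < p.node.length → c = !p.node.sign b)) :=
    let ⟨b, hb⟩ := hS A hA p.skel
    ⟨b, fun c h => hb c h.1⟩
  obtain ⟨ν, hν, hνlen⟩ := Node.exists_forall_lt_of_undecided hundec
  have hle : p.node.length ≤ ν.length := by
    by_contra! hlt
    exact hνlen _ ⟨⟨_, p.thin _ hlt⟩, fun _ => rfl⟩
  exact ⟨ν, ⟨hle, fun b hb => (Bool.not_inj ((hν b (hb.trans_le hle)).2 hb)).symm⟩,
    fun b hb => (hν b hb).1, fun c hc => hνlen c ⟨hc, fun h => absurd h hle.not_gt⟩⟩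

theorem exists_pairwise_incompatible [NoMaxOrder K] (hS : SplitsSkeletons S) (hA : IsAD A)
    (p : DecidedSkeleton S (generatedIdeal A)) :
    ∃ q : Bool → DecidedSkeleton S (generatedIdeal A), (∀ c, q c ≤ p) ∧
      Pairwise fun c d => (q c).node.Incompatible (q d).node := by
  classical
  obtain ⟨ν, hpν, hν, hνlen⟩ := p.exists_node_ge hS hA
  obtain ⟨b', hb'⟩ := exists_covBy_of_wellFoundedLT (not_isMax ν.length)
  let μ : Bool → Node K := fun c => ⟨b', Function.update ν.sign ν.length c⟩
  have hμ : ∀ c, ν ≤ μ c := fun c =>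
    ⟨hb'.le, fun b hb => (Function.update_of_ne hb.ne _ _).symm⟩
  have hμ_sign : ∀ c, (μ c).sign ν.length = c := fun c => Function.update_self _ _ _
  have hq : ∀ c, ∃ r ≤ p, r.node = μ c := by
    intro c
    obtain ⟨q, hqp, hqc⟩ := (p.skel.thin_or_exists_le (side (S ν.length) c)).resolve_left (hνlen c)
    have hthin : ∀ b < b', q.Thin (side (S b) (!(μ c).sign b)) := by
      intro b hb
      rcases (hb'.lt_iff_le_left.1 hb).lt_or_eq with hlt | rfl
      · rw [← (hμ c).2 b hlt]
        exact (hν b hlt).anti hqp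
      · rw [hμ_sign, side_not]
        exact Skeleton.thin_of_succ_subset_compl fun t ht => by
          rw [compl_compl]
          exact hqc t ht
    obtain ⟨r, hrp, -, hr⟩ := p.exists_le_of_thin hqp (hpν.trans (hμ c)) hthin
    exact ⟨r, hrp, hr⟩
  choose q hqp hqμ using hq
  refine ⟨q, hqp, fun c d hcd => ⟨ν.length, ?_⟩⟩
  rw [hqμ, hqμ, hμ_sign, hμ_sign]
  exact ⟨hb'.lt, hb'.lt, hcd⟩

end DecidedSkeleton

end DecidedSkeleton

section Stage

variable {K : Type} [LinearOrder K] {S : K → Set ℕ} {D : Set (Set ℕ)}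
  {G : Set (Set ℕ × Node K)}

/-- A stage of the fusion: a decided skeleton with a distinguished node `root` and an infinite set
`petals` of successors of `root` that is almost disjoint from all current obstacles. -/
structure Stage (S : K → Set ℕ) (G : Set (Set ℕ × Node K)) extends
    DecidedSkeleton S (generatedIdeal (Prod.fst '' G)) where
  root : List ℕ
  petals : Set ℕ
  root_mem : root ∈ skel.nodes
  infinite : petals.Infinite
  petals_subset : petals ⊆ skel.succ root
  finite_inter : ∀ i ∈ obstacles G node,
    (petals ∩ Sum.elim (fun b => null b root) Prod.fst i).Finite

namespace Stage

/-- The set which an index of an obstacle stands for at the given stage. -/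
def obstacle (s : Stage S G) : K ⊕ Set ℕ × Node K → Set ℕ :=
  Sum.elim (fun b => s.null b s.root) Prod.fst

theorem exists_root_eq (hG : IsLabelledAD S D G)
    (p : DecidedSkeleton S (generatedIdeal (Prod.fst '' G)))
    (hcard : #(obstacles G p.node) < almostDisjointnessNumber) {t : List ℕ}
    (ht : t ∈ p.skel.nodes) : ∃ s : Stage S G, s.toDecidedSkeleton = p ∧ s.root = t := by
  obtain ⟨Z, hZ, hZinf, hfin⟩ := hG.exists_infinite_subset_forall_obstacles hcard
    (fun b hb => (p.thin b hb).1 t ht) (p.skel.succ_notMem t ht)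
  exact ⟨⟨p, t, Z, ht, hZinf, hZ, hfin⟩, rfl, rfl⟩

theorem exists_bound (s : Stage S G) :
    ∃ h : K ⊕ Set ℕ × Node K → ℕ, ∀ i ∈ obstacles G s.node, ∀ n ∈ s.petals ∩ s.obstacle i,
      n ≤ h i := by
  have hbdd : ∀ i ∈ obstacles G s.node, BddAbove (s.petals ∩ s.obstacle i) := fun i hi =>
    (s.finite_inter i hi).bddAbove
  choose! h hh using hbdd
  exact ⟨h, fun i hi n hn => hh i hi hn⟩

theorem exists_next [WellFoundedLT K] [NoMaxOrder K] (hG : IsLabelledAD S D G)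
    (hS : SplitsSkeletons S) (hcard : ∀ ν, #(obstacles G ν) < almostDisjointnessNumber)
    (s : Stage S G) {n : ℕ} (hn : n ∈ s.petals) :
    ∃ q : Bool → Stage S G,
      (∀ c, (q c).toDecidedSkeleton ≤ s.toDecidedSkeleton ∧ s.root ++ [n] <+: (q c).root) ∧
        Pairwise fun c d => (q c).node.Incompatible (q d).node := by
  obtain ⟨p, hps, hpn⟩ := s.exists_le_forall_isPrefix s.root_mem (s.petals_subset hn)
  obtain ⟨q, hqp, hq⟩ := p.exists_pairwise_incompatible hS hG.isAD
  have hstage : ∀ c, ∃ r : Stage S G, r.toDecidedSkeleton = q c ∧ s.root ++ [n] <+: r.root := by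
    intro c
    obtain ⟨t, ht⟩ := (q c).skel.nonempty
    obtain ⟨r, hr, rfl⟩ := exists_root_eq hG (q c) (hcard _) ht
    exact ⟨r, hr, hpn _ ((hqp c).1.1 ht)⟩
  choose r hrq hrn using hstage
  simp only [← hrq] at hqp hq
  exact ⟨r, fun c => ⟨(hqp c).trans hps, hrn c⟩, hq⟩

end Stage

/-- A run of the fusion: stages `s k` of increasing strength, whose roots lie on one branch, which
leaves the root of `s k` by the petal `n k`. -/
def IsRun (s : ℕ → Stage S G) (n : ℕ → ℕ) : Prop :=
  ∀ k, n k ∈ (s k).petals ∧ (s (k + 1)).toDecidedSkeleton ≤ (s k).toDecidedSkeleton ∧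
    (s k).root ++ [n k] <+: (s (k + 1)).root

namespace IsRun

variable {s : ℕ → Stage S G} {n : ℕ → ℕ}

theorem antitone (h : IsRun s n) : Antitone fun k => (s k).toDecidedSkeleton :=
  antitone_nat_of_succ_le fun k => (h k).2.1

theorem isPath (h : IsRun s n) (k₀ : ℕ) :
    (s k₀).skel.IsPath (fun k => (s (k + k₀)).root) fun k => n (k + k₀) := by
  intro k
  have hle := h.antitone (Nat.le_add_left k₀ k)
  refine ⟨hle.1.1 (s _).root_mem, hle.1.2 _ (s _).root_mem ((s _).petals_subset (h _).1), ?_⟩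
  simpa only [add_right_comm k 1 k₀] using (h (k + k₀)).2.2

theorem exists_obstacle (h : IsRun s n) (hG : IsLabelledAD S D G) (hn : Tendsto n atTop atTop)
    {y : Set ℕ × Node K} (hy : y ∈ G) (hsy : ∃ k, ¬(s k).node ≤ y.2) :
    ∃ i, ∀ᶠ k in atTop, i ∈ obstacles G (s k).node ∧ (n k ∈ y.1 → n k ∈ (s k).obstacle i) := by
  obtain ⟨k₀, hk₀⟩ := hsy
  rcases Node.le_or_le_or_incompatible (s k₀).node y.2 with hle | hle | ⟨b, hb, hby, hne⟩
  · exact absurd hle hk₀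
  · refine ⟨Sum.inr y, (eventually_ge_atTop k₀).mono fun k hk => ⟨?_, id⟩⟩
    exact Or.inr ⟨y, ⟨hy, hle.trans (h.antitone hk).2.1⟩, rfl⟩
  · have hthin := ((s k₀).thin b hb).2 _ _ (h.isPath k₀)
    have hfollows : ∀ᶠ k in atTop, n k ∉ y.1 \ side (S b) (y.2.sign b) :=
      hn.eventually (Nat.cofinite_eq_atTop ▸ (hG.follows y hy b hby).eventually_cofinite_notMem)
    refine ⟨Sum.inl b, ?_⟩
    filter_upwards [eventually_ge_atTop k₀, hfollows,
      (tendsto_sub_atTop_nat k₀).eventually hthin] with k hk hky hkN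
    obtain ⟨-, hnode, hnull⟩ := h.antitone hk
    refine ⟨Or.inl ⟨b, hb.trans_le hnode.1, rfl⟩, fun hny => ?_⟩
    simp only [Nat.sub_add_cancel hk, ← hnull b hb, Bool.not_eq.2 hne] at hkN
    exact hkN (not_not.1 fun hside => hky ⟨hny, hside⟩)

theorem range_notMem (h : IsRun s n) (hG : IsLabelledAD S D G) (hn : Tendsto n atTop atTop)
    (hsG : ∀ y ∈ G, ∃ k, ¬(s k).node ≤ y.2)
    (hesc : ∀ E : Finset (K ⊕ Set ℕ × Node K),
      (∀ᶠ k in atTop, ∀ i ∈ E, i ∈ obstacles G (s k).node) →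
        ∃ᶠ k in atTop, ∀ i ∈ E, n k ∉ (s k).obstacle i) :
    range n ∉ generatedIdeal (Prod.fst '' G) := by
  classical
  rintro ⟨F, hF, hFG, hfin⟩
  have hobs : ∀ B ∈ F, ∃ i, ∀ᶠ k in atTop,
      i ∈ obstacles G (s k).node ∧ (n k ∈ B → n k ∈ (s k).obstacle i) := by
    intro B hB
    obtain ⟨y, hy, rfl⟩ := hFG hB
    exact h.exists_obstacle hG hn hy (hsG y hy)
  have : Nonempty (K ⊕ Set ℕ × Node K) := ⟨Sum.inl (s 0).node.length⟩
  choose! i hi using hobs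
  have hev := (eventually_all_finite hF).2 hi
  have hcov : ∀ᶠ k in atTop, n k ∉ range n \ ⋃₀ F :=
    hn.eventually (Nat.cofinite_eq_atTop ▸ hfin.eventually_cofinite_notMem)
  have hfreq := hesc (hF.toFinset.image i) <| hev.mono fun k hk =>
    Finset.forall_mem_image.2 fun B hB => (hk B (hF.mem_toFinset.1 hB)).1
  obtain ⟨k, hk, hkF, hkcov⟩ := (hfreq.and_eventually (hev.and hcov)).exists
  refine hkcov ⟨mem_range_self k, fun ⟨B, hB, hkB⟩ => hk (i B) ?_ ((hkF B hB).2 hkB)⟩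
  exact Finset.mem_image_of_mem i (hF.mem_toFinset.2 hB)

end IsRun

theorem Node.exists_forall_exists_not_le {α : Type*} {ν : List (α × Bool) → Node K}
    (hν : ∀ w m, Pairwise fun c d => (ν ((m, c) :: w)).Incompatible (ν ((m, d) :: w)))
    (g : ℕ → α) {N : Set (Node K)} (hN : #N < 𝔠) :
    ∃ x : ℕ → Bool, ∀ τ ∈ N, ∃ k, ¬ν (PiNat.res (fun j => (g j, x j)) k) ≤ τ := by
  let w : (ℕ → Bool) → ℕ → List (α × Bool) := fun x => PiNat.res fun j => (g j, x j)
  have hinc : ∀ x y, x ≠ y → ∃ k, (ν (w x k)).Incompatible (ν (w y k)) := by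
    intro x y hxy
    have hw : w x (PiNat.firstDiff x y) = w y (PiNat.firstDiff x y) :=
      PiNat.res_eq_res.2 fun i hi => congrArg (g i, ·) (PiNat.apply_eq_of_lt_firstDiff hi)
    refine ⟨PiNat.firstDiff x y + 1, ?_⟩
    simp only [w, PiNat.res_succ] at hw ⊢
    rw [hw]
    exact hν _ _ (PiNat.apply_firstDiff_ne hxy)
  obtain ⟨x, hx⟩ : {x | ∀ τ ∈ N, ¬∀ k, ν (w x k) ≤ τ}.Nonempty := by
    refine (infinite_setOf_forall_not (by simpa using hN) fun τ _ x y hx hy => ?_).nonempty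
    by_contra hne
    obtain ⟨k, hk⟩ := hinc x y hne
    exact Node.not_incompatible_self (hk.mono (hx k) (hy k))
  exact ⟨x, fun τ hτ => not_forall.1 (hx τ hτ)⟩

theorem Stage.exists_isRun [WellFoundedLT K] [NoMaxOrder K] (hG : IsLabelledAD S D G)
    (hS : SplitsSkeletons S) (hobs : ∀ ν, #(obstacles G ν) < splittingNumber)
    (hsa : splittingNumber ≤ almostDisjointnessNumber) (hcard : #G < 𝔠) (s₀ : Stage S G) :
    ∃ s n, s 0 = s₀ ∧ IsRun s n ∧ Tendsto n atTop atTop ∧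
      (∀ y ∈ G, ∃ k, ¬(s k).node ≤ y.2) ∧
        ∀ E : Finset (K ⊕ Set ℕ × Node K),
          (∀ᶠ k in atTop, ∀ i ∈ E, i ∈ obstacles G (s k).node) →
            ∃ᶠ k in atTop, ∀ i ∈ E, n k ∉ (s k).obstacle i := by
  classical
  have hnext : ∀ (s : Stage S G) (m : ℕ), ∃ n ∈ s.petals, m < n ∧ ∃ q : Bool → Stage S G,
      (∀ c, (q c).toDecidedSkeleton ≤ s.toDecidedSkeleton ∧ s.root ++ [n] <+: (q c).root) ∧
        Pairwise fun c d => (q c).node.Incompatible (q d).node := by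
    intro s m
    obtain ⟨n, hn, hmn⟩ := s.infinite.exists_gt m
    exact ⟨n, hn, hmn, s.exists_next hG hS (fun ν => (hobs ν).trans_le hsa) hn⟩
  choose n hn hmn next hnext hinc using hnext
  choose h hh using fun s : Stage S G => s.exists_bound
  let stage : List (ℕ × Bool) → Stage S G := fun w => w.foldr (fun e s => next s e.1 e.2) s₀
  obtain ⟨g, hg, hgh⟩ := exists_strictMono_history_escaping
    (act := fun w => obstacles G (stage w).node) (fun w => hobs _) fun w => h (stage w)
  let s : (ℕ → Bool) → ℕ → Stage S G := fun x k => stage (PiNat.res (fun j => (g j, x j)) k)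
  have hrun : ∀ x, IsRun (s x) fun k => n (s x k) (g k) := fun x k =>
    ⟨hn _ _, hnext (s x k) (g k) (x k)⟩
  obtain ⟨x, hx⟩ := Node.exists_forall_exists_not_le (ν := fun w => (stage w).node)
    (fun w m => hinc (stage w) m) g ((mk_image_le (f := Prod.snd)).trans_lt hcard)
  refine ⟨s x, _, rfl, hrun x, tendsto_atTop_mono (fun k => (hmn _ _).le) hg.tendsto_atTop,
    fun y hy => hx _ (mem_image_of_mem _ hy), fun E hE => ?_⟩
  obtain ⟨k₀, hk₀⟩ := eventually_atTop.1 hE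
  have hfreq := hgh _ (E.subtype (· ∈ obstacles G (s x k₀).node))
  refine (hfreq.and_eventually (eventually_ge_atTop k₀)).mono fun k ⟨hk, hkk₀⟩ i hi hni => ?_
  have hlt : h (s x k) i < g k := hk x ⟨i, hk₀ k₀ le_rfl i hi⟩ (Finset.mem_subtype.2 hi)
  have hle : n (s x k) (g k) ≤ h (s x k) i := hh _ i (hk₀ k hkk₀ i hi) _ ⟨hn _ _, hni⟩
  exact (hlt.trans (hmn _ _)).not_ge hle

theorem exists_mem_branches_range_subset {T : Descriptive.tree ℕ} {t : ℕ → List ℕ} {n : ℕ → ℕ}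
    (ht : ∀ k, t k ∈ T) (htn : ∀ k, t k ++ [n k] <+: t (k + 1)) :
    ∃ f ∈ branches T, range n ⊆ range f := by
  have hmono : ∀ j k, j ≤ k → t j <+: t k := fun j k hjk => by
    induction k, hjk using Nat.le_induction with
    | base => exact List.prefix_rfl
    | succ k _ ih => exact ih.trans ((List.prefix_append _ _).trans (htn k))
  have hlen : StrictMono fun k => (t k).length := strictMono_nat_of_lt_succ fun k => by
    simpa [Nat.succ_le_iff] using (htn k).length_le
  let f : ℕ → ℕ := fun i => (t (i + 1)).getD i 0
  have hget : ∀ k i, ∀ hi : i < (t k).length, (t k)[i] = f i := by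
    intro k i hi
    have hi' : i < (t (i + 1)).length := hlen.le_apply (x := i + 1)
    rw [show f i = (t (i + 1))[i] from List.getD_eq_getElem _ _ hi']
    rcases le_total k (i + 1) with hle | hle
    · exact (hmono _ _ hle).getElem hi
    · exact ((hmono _ _ hle).getElem hi').symm
  refine ⟨f, fun k => Descriptive.Tree.mem_of_prefix (y := t k) ?_ (ht k), ?_⟩
  · have htake : (List.range k).map f = (t k).take k :=
      List.ext_getElem (by simpa using hlen.le_apply) fun i hi hi' => by
        rw [List.getElem_map, List.getElem_range, List.getElem_take, hget]
    exact htake ▸ List.take_prefix _ _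
  · rintro _ ⟨k, rfl⟩
    have hk : (t k).length < (t k ++ [n k]).length := by simp
    exact ⟨(t k).length, by rw [← hget (k + 1) _ (hlen k.lt_succ_self), ← (htn k).getElem hk]; simp⟩

theorem IsLabelledAD.exists_mem_branches_range_notMem [WellFoundedLT K] [NoMaxOrder K]
    (hG : IsLabelledAD S D G) (hS : SplitsSkeletons S)
    (hK : ∀ b : K, #(Iio b) < splittingNumber)
    (hsa : splittingNumber ≤ almostDisjointnessNumber) (hcard : #G < 𝔠)
    {T : Descriptive.tree ℕ} (hT : IsBranching (positive (generatedIdeal (Prod.fst '' G))) T) :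
    ∃ f ∈ branches T, range f ∉ generatedIdeal (Prod.fst '' G) := by
  let p : Skeleton (generatedIdeal (Prod.fst '' G)) :=
    { nodes := {t | t ∈ T}
      succ := successors T
      nonempty := ⟨[], hT.1⟩
      succ_notMem := hT.2
      exists_extends := fun t _ n hn => ⟨t ++ [n], hn, List.prefix_rfl⟩ }
  have hobs : ∀ ν, #(obstacles G ν) < splittingNumber :=
    hG.mk_obstacles_lt aleph0_le_splittingNumber hK
  obtain ⟨q, hqp⟩ := DecidedSkeleton.exists_skel_eq hS hG.isAD p
  have hroot : [] ∈ q.skel.nodes := by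
    rw [hqp]
    exact hT.1
  obtain ⟨s₀, rfl, -⟩ := Stage.exists_root_eq hG q ((hobs _).trans_le hsa) hroot
  obtain ⟨s, n, rfl, hrun, hn, hsG, hesc⟩ := s₀.exists_isRun hG hS hobs hsa hcard
  have hpath := hrun.isPath 0
  rw [hqp] at hpath
  obtain ⟨f, hf, hnf⟩ := exists_mem_branches_range_subset (fun k => (hpath k).1)
    fun k => (hpath k).2.2
  exact ⟨f, hf, fun hmem => hrun.range_notMem hG hn hsG hesc
    ((generatedIdeal (Prod.fst '' G)).lower hnf hmem)⟩

end Stage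

section Recursion

theorem mk_Iio_ord_toType_lt {κ : Cardinal.{u}} (c : κ.ord.ToType) : #(Iio c) < κ := by
  simpa using mk_Iio_lt c (by simp)

variable {α τ C : Type u} {κ : Cardinal.{u}} {G₀ : Set α} {N : C → Set α}
  {s : Set C} {P : Set α → Prop}

/-- The union of the sets `N b` for `b ∈ s`, together with the initial set `G₀`: the family built in
the steps `s` of a recursion that starts from `G₀` and adds `N b` in step `b`. -/
def unionFrom (G₀ : Set α) (N : C → Set α) (s : Set C) : Set α := G₀ ∪ ⋃ b ∈ s, N b

theorem unionFrom_mono : Monotone (unionFrom G₀ N) := fun _ _ h =>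
  union_subset_union_right _ (biUnion_subset_biUnion_left h)

theorem mk_unionFrom_lt (hκ : ℵ₀ < κ) (hG₀ : #G₀ < κ) (hs : #s < κ)
    (hN : ∀ b ∈ s, (N b).Countable) : #(unionFrom G₀ N s) < κ := by
  refine (mk_union_le _ _).trans_lt (add_lt_of_lt hκ.le hG₀ ?_)
  refine (mk_biUnion_le _ _).trans_lt (mul_lt_of_lt hκ.le hs ?_)
  exact (ciSup_le' fun b : s => mk_le_aleph0_iff.2 (hN b b.2).to_subtype).trans_lt hκ

variable [LinearOrder C]

theorem unionFrom_Iic (c : C) : unionFrom G₀ N (Iic c) = unionFrom G₀ N (Iio c) ∪ N c := by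
  rw [unionFrom, unionFrom, ← Iio_insert, biUnion_insert, union_comm (N c), union_assoc]

theorem unionFrom_of_forall_Iic (hs : IsLowerSet s) (hG₀ : P G₀)
    (hP : ∀ 𝒢 : Set (Set α), IsChain (· ⊆ ·) 𝒢 → (∀ G ∈ 𝒢, P G) → P (⋃₀ 𝒢))
    (h : ∀ b ∈ s, P (unionFrom G₀ N (Iic b))) : P (unionFrom G₀ N s) := by
  have hunion : unionFrom G₀ N s = ⋃₀ insert G₀ ((fun b => unionFrom G₀ N (Iic b)) '' s) := by
    rw [sUnion_insert, sUnion_image]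
    refine (union_subset_union_right _ (iUnion₂_mono fun b _ => ?_)).antisymm
      (union_subset subset_union_left (iUnion₂_subset fun b hb => ?_))
    · exact (subset_biUnion_of_mem self_mem_Iic).trans subset_union_right
    · exact unionFrom_mono fun c hc => hs hc hb
  have hchain : IsChain (· ⊆ ·) ((fun b => unionFrom G₀ N (Iic b)) '' s) :=
    (unionFrom_mono.comp monotone_Iic).isChain_range.mono (image_subset_range _ _)
  rw [hunion]
  refine hP _ (hchain.insert ?_) ?_
  · rintro _ ⟨b, -, rfl⟩ -
    exact Or.inl subset_union_left
  · rintro _ (rfl | ⟨b, hb, rfl⟩)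
    exacts [hG₀, h b hb]

theorem exists_superset_forall_requirement [Nonempty τ] {Q : τ → Set α → Set α → Prop}
    (hκ : ℵ₀ < κ) (hτ : #τ ≤ κ) (hG₀ : P G₀) (hcard : #G₀ < κ)
    (hP : ∀ 𝒢 : Set (Set α), IsChain (· ⊆ ·) 𝒢 → (∀ G ∈ 𝒢, P G) → P (⋃₀ 𝒢))
    (hstep : ∀ G t, P G → #G < κ → ∃ N : Set α, N.Countable ∧ P (G ∪ N) ∧ Q t G N) :
    ∃ G, G₀ ⊆ G ∧ P G ∧ ∀ t, ∃ G₁ ⊆ G, ∃ N ⊆ G, Q t G₁ N := by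
  obtain ⟨emb⟩ : Nonempty (τ ↪ κ.ord.ToType) := by rwa [← Cardinal.le_def, mk_ord_toType]
  let e := Function.invFun emb
  choose! step hcount hPstep hQ using hstep
  let N : κ.ord.ToType → Set α :=
    WellFoundedLT.fix fun c ih => step (G₀ ∪ ⋃ (b) (h : b ∈ Iio c), ih b h) (e c)
  have hN : ∀ c, N c = step (unionFrom G₀ N (Iio c)) (e c) := fun c => WellFoundedLT.fix_eq _ c
  have hmain : ∀ c, P (unionFrom G₀ N (Iio c)) ∧ #(unionFrom G₀ N (Iio c)) < κ ∧
      (N c).Countable ∧ P (unionFrom G₀ N (Iic c)) := by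
    intro c
    induction c using WellFoundedLT.induction with
    | ind c ih =>
      have hPc : P (unionFrom G₀ N (Iio c)) :=
        unionFrom_of_forall_Iic (isLowerSet_Iio c) hG₀ hP fun b hb => (ih b hb).2.2.2
      have hc : #(unionFrom G₀ N (Iio c)) < κ := mk_unionFrom_lt hκ hcard
        (mk_Iio_ord_toType_lt c) fun b hb => (ih b hb).2.2.1
      rw [unionFrom_Iic, hN]
      exact ⟨hPc, hc, hcount _ _ hPc hc, hPstep _ _ hPc hc⟩
  refine ⟨unionFrom G₀ N Set.univ, subset_union_left,
    unionFrom_of_forall_Iic isLowerSet_univ hG₀ hP fun b _ => (hmain b).2.2.2, fun t => ?_⟩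
  obtain ⟨c, rfl⟩ := Function.invFun_surjective emb.injective t
  refine ⟨unionFrom G₀ N (Iio c), unionFrom_mono (subset_univ _), N c,
    (subset_biUnion_of_mem (mem_univ c)).trans subset_union_right, ?_⟩
  rw [hN]
  exact hQ _ _ (hmain c).1 (hmain c).2.1

end Recursion

section Saturation

variable {A : Set (Set ℕ)} {X : Set ℕ}

/-- Every `𝓘(A)⁺`-branching tree has a branch whose range contains infinitely many members of `A`.
For an infinite almost disjoint family this yields both maximality and the `+`-Ramsey property. -/
def IsSaturated (A : Set (Set ℕ)) : Prop :=
  ∀ T, IsBranching (positive (generatedIdeal A)) T →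
    ∃ f ∈ branches T, {B ∈ A | B ⊆ range f}.Infinite

theorem IsSaturated.isPlusRamsey (hsat : IsSaturated A) (hA : IsAD A) : IsPlusRamsey A := by
  intro T hT
  obtain ⟨f, hf, hinf⟩ := hsat T hT
  refine ⟨f, hf, hA.notMem_generatedIdeal (hinf.mono ?_)⟩
  rintro B ⟨hB, hBf⟩
  refine ⟨hB, ?_⟩
  rw [inter_eq_self_of_subset_right hBf]
  exact hA.1 B hB

/-- The tree of all finite sequences with entries in `X`, which turns statements about branches
into statements about subsets of `X`. -/
def fullTree (X : Set ℕ) : Descriptive.tree ℕ :=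
  ⟨{s | ∀ n ∈ s, n ∈ X}, fun _ _ h n hn => h n (List.mem_append_left _ hn)⟩

theorem mem_fullTree {s : List ℕ} : s ∈ fullTree X ↔ ∀ n ∈ s, n ∈ X := Iff.rfl

theorem isBranching_fullTree {𝒳 : Set (Set ℕ)} (hX : X ∈ 𝒳) : IsBranching 𝒳 (fullTree X) := by
  refine ⟨mem_fullTree.2 (by simp), fun s hs => ?_⟩
  have hsucc : successors (fullTree X) s = X := by
    ext n
    refine ⟨fun h => mem_fullTree.1 h n (by simp), fun h => mem_fullTree.2 ?_⟩
    simpa [or_imp, forall_and] using ⟨mem_fullTree.1 hs, h⟩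
  rwa [hsucc]

theorem range_subset_of_mem_branches_fullTree {f : ℕ → ℕ} (hf : f ∈ branches (fullTree X)) :
    range f ⊆ X := by
  rintro _ ⟨k, rfl⟩
  exact mem_fullTree.1 (hf (k + 1)) _ (List.mem_map_of_mem (by simp))

theorem IsSaturated.isMAD (hsat : IsSaturated A) (hinf : A.Infinite) (hA : IsAD A) : IsMAD A := by
  refine ⟨hinf, hA, fun A' hA' hAA' X hX => by_contra fun hXA => ?_⟩
  have hfin : ∀ B ∈ A, (X ∩ B).Finite := fun B hB =>
    hA'.2 hX (hAA' hB) fun h => hXA (h ▸ hB)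
  obtain ⟨f, hf, hAf⟩ := hsat _ (isBranching_fullTree
    (notMem_generatedIdeal_of_forall_finite_inter (hA'.1 X hX) hfin))
  obtain ⟨B, hB, hBf⟩ := hAf.nonempty
  have hBX := hBf.trans (range_subset_of_mem_branches_fullTree hf)
  exact hA.1 B hB (inter_eq_self_of_subset_right hBX ▸ hfin B hB)

theorem IsBranching.anti {A A' : Set (Set ℕ)} (h : A ⊆ A') {T : Descriptive.tree ℕ}
    (hT : IsBranching (positive (generatedIdeal A')) T) :
    IsBranching (positive (generatedIdeal A)) T :=
  ⟨hT.1, fun s hs hmem => hT.2 s hs (generatedIdeal_mono h hmem)⟩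

variable {K : Type} [LinearOrder K] [NoMaxOrder K] [WellFoundedLT K] {S : K → Set ℕ}
  {D : Set (Set ℕ)} {G : Set (Set ℕ × Node K)}

theorem IsLabelledAD.exists_extension_range (hG : IsLabelledAD S D G) (hD : IsDenseFamily D)
    (hK : ∀ b : K, #(Iio b) < splittingNumber)
    (hsa : splittingNumber ≤ almostDisjointnessNumber) (hS : SplitsSkeletons S) (hcard : #G < 𝔠)
    (T : Descriptive.tree ℕ) :
    ∃ N : Set (Set ℕ × Node K), N.Countable ∧ IsLabelledAD S D (G ∪ N) ∧
      (IsBranching (positive (generatedIdeal (Prod.fst '' G))) T →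
        N.Infinite ∧ ∃ f ∈ branches T, ∀ y ∈ N, y.1 ⊆ range f) := by
  by_cases hT : IsBranching (positive (generatedIdeal (Prod.fst '' G))) T
  · obtain ⟨f, hf, hfG⟩ := hG.exists_mem_branches_range_notMem hS hK hsa hcard hT
    obtain ⟨N, hN, hNinf, hGN, hNf⟩ :=
      hG.exists_extension hD (fun b => (hK b).trans_le hsa) hS hcard hfG
    exact ⟨N, hN, hGN, fun _ => ⟨hNinf, f, hf, hNf⟩⟩
  · exact ⟨∅, countable_empty, by rwa [union_empty], fun h => absurd h hT⟩

theorem SplitsSkeletons.exists_isLabelledAD_infinite (hS : SplitsSkeletons S)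
    (hD : IsDenseFamily D) (hK : ∀ b : K, #(Iio b) < almostDisjointnessNumber) :
    ∃ G : Set (Set ℕ × Node K), G.Countable ∧ G.Infinite ∧ IsLabelledAD S D G := by
  have huniv : Set.univ ∉ generatedIdeal (Prod.fst '' (∅ : Set (Set ℕ × Node K))) :=
    notMem_generatedIdeal_of_forall_finite_inter infinite_univ (by simp)
  obtain ⟨N, hN, hNinf, hlab, -⟩ :=
    IsLabelledAD.empty.exists_extension hD hK hS (by simp [continuum_pos]) huniv
  exact ⟨N, hN, hNinf, by rwa [empty_union] at hlab⟩

theorem SplitsSkeletons.exists_isLabelledAD_isSaturated (hS : SplitsSkeletons S)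
    (hD : IsDenseFamily D) (hK : ∀ b : K, #(Iio b) < splittingNumber)
    (hsa : splittingNumber ≤ almostDisjointnessNumber) :
    ∃ G : Set (Set ℕ × Node K), G.Infinite ∧ IsLabelledAD S D G ∧
      IsSaturated (Prod.fst '' G) := by
  obtain ⟨G₀, hcount, hinf, hG₀⟩ :=
    hS.exists_isLabelledAD_infinite hD fun b => (hK b).trans_le hsa
  have htree : #(Descriptive.tree ℕ) ≤ 𝔠 := (mk_subtype_le _).trans (by simp)
  obtain ⟨G, hG₀G, hG, hreq⟩ := exists_superset_forall_requirement aleph0_lt_continuum htree hG₀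
    (hcount.le_aleph0.trans_lt aleph0_lt_continuum) (fun 𝒢 => IsLabelledAD.sUnion)
    fun G T hG hcard => hG.exists_extension_range hD hK hsa hS hcard T
  refine ⟨G, hinf.mono hG₀G, hG, fun T hT => ?_⟩
  obtain ⟨G₁, hG₁, N, hN, hTN⟩ := hreq T
  obtain ⟨hNinf, f, hf, hNf⟩ := hTN (hT.anti (image_mono hG₁))
  refine ⟨f, hf, (hNinf.image (hG.injOn_fst.mono hN)).mono ?_⟩
  exact image_subset_iff.2 fun y hy => ⟨mem_image_of_mem _ (hN hy), hNf y hy⟩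

end Saturation

end PlusRamsey

open PlusRamsey Cardinal in
theorem corollary25_general (h : splittingNumber ≤ almostDisjointnessNumber)
    (D : Set (Set ℕ)) (hD : IsDenseFamily D) :
    ∃ A : Set (Set ℕ), IsMAD A ∧ IsPlusRamsey A ∧ A ⊆ D := by
  have : NoMaxOrder splittingNumber.ord.ToType := noMaxOrder aleph0_le_splittingNumber
  obtain ⟨S, hS⟩ := exists_splitsSkeletons (mk_ord_toType splittingNumber)
  obtain ⟨G, hinf, hG, hsat⟩ := hS.exists_isLabelledAD_isSaturated hD mk_Iio_ord_toType_lt h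
  exact ⟨Prod.fst '' G, hsat.isMAD (hinf.image hG.injOn_fst) hG.isAD, hsat.isPlusRamsey hG.isAD,
    Set.image_subset_iff.2 fun y hy => hG.mem y hy⟩

theorem corollary25
    (h : PlusRamsey.splittingNumber ≤ PlusRamsey.almostDisjointnessNumber)
    (I : Order.Ideal (Set ℕ)) (hI : PlusRamsey.IsTall I) :
    ∃ A : Set (Set ℕ),
      PlusRamsey.IsMAD A ∧ PlusRamsey.IsPlusRamsey A ∧ A ⊆ (I : Set (Set ℕ)) :=
  corollary25_general h _ hI.isDenseFamily
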